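/- **Setting.** A *quantum Markov decision process* (qMDP) $\mathcal M=\langle\mathcal H,Act,\mathbf M,Q\rangle$ consists of a Hilbert space $\mathcal H=\mathbb C^d$; a finite set $Act$ of actions, each $\alpha\in Act$ with a trace-preserving super-operator $\mathcal E_\alpha(\rho)=\sum_{i=1}^{n_\alpha}A_{\alpha i}\rho A_{\alpha i}^\dagger$, $\sum_i A_{\alpha i}^\dagger A_{\alpha i}=I$; a finite set $\mathbf M$ of quantum measurements $M_\beta=\{M_{\beta 1},\dots,M_{\beta k_\beta}\}$, $\sum_j M_{\beta j}^\dagger M_{\beta j}=I$; and a map $Q:Act\cup\mathbf M\to 2^{Act\cup\mathbf M}$ giving the actions and measurements available after each action or measurement. Let $\Omega$ be the set of pairs (measurement, outcome). A *scheduler* is a function $\mathfrak S:(Act\cup\Omega)^*\to Act\cup\mathbf M$ that, after every non-empty history that can arise from its own choices, selects an element available according to $Q$ after the last action or measurement performed (the first choice is free; if $Q$ is trivial, i.e. always equal to $Act\cup\mathbf M$, every function is a scheduler). Given an initial density matrix $\rho$ and a scheduler $\mathfrak S$, put $\rho_\epsilon=\rho$, $p_\epsilon=1$; if $\mathfrak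 S(w)=\alpha\in Act$, put $\rho_{w\alpha}=\mathcal E_\alpha(\rho_w)$, $p_{w\alpha}=p_w$; if $\mathfrak S(w)=M_\beta$ and $o$ is the outcome $j$ of $M_\beta$, put $p_{wo}=p_w\,\mathrm{tr}(M_{\beta j}\rho_wM_{\beta j}^\dagger)$ and $\rho_{wo}=M_{\beta j}\rho_wM_{\beta j}^\dagger/\mathrm{tr}(M_{\beta j}\rho_wM_{\beta j}^\dagger)$; all other words have probability $0$. Let $\rho(n,\mathfrak S)=\sum_{|w|=n}p_w\rho_w$, and for a subspace $B\subseteq\mathcal H$ with orthogonal projection $P_B$ let $\Pr^{\mathfrak S}(\rho\vDash\Diamond B)=\lim_{n\to\infty}\mathrm{tr}(P_B\,\rho(n,\mathfrak S))$. The subspace $B$ is *invariant* if, for every density matrix $\rho$ with $\mathrm{supp}(\rho)\subseteq B$, the supports of all $\mathcal E_\alpha(\rho)$ and of all $M_{\beta j}\rho M_{\beta j}^\dagger$ are contained in $B$; then the limit exists. **Theorem.** Consider qMDPs $\mathcal M$ and invariant subspaces $B$ such that all operators $A_{\alpha i}$ and $M_{\beta j}$ are of the form $a\,|\varphi\rangle\langle\psi|$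 with $a\in\mathbb C$, and let $N=\max(\{n_\alpha:\alpha\in Act\}\cup\{k_\beta:M_\beta\in\mathbf M\})$. There are one algorithm and one polynomial $p$ such that, for every such $\mathcal M$ and $B$, the algorithm decides whether $\Pr^{\mathfrak S}(\rho\vDash\Diamond B)=1$ holds for all schedulers $\mathfrak S$ and all initial states $\rho$, in time at most $p\big((|Act|+|\mathbf M|)\,2^N\big)$. Here time is the number of steps of a unit-cost real random access machine (exact arithmetic operations and comparisons of real numbers with constants $0,1$; addition, subtraction and comparison of natural numbers; array access). The input consists of $d$, $|Act|$, $|\mathbf M|$, the numbers $n_\alpha,k_\beta$, the table of $Q$, and the real and imaginary parts of the entries of $P_B$ and of all $A_{\alpha i}$, $M_{\beta j}$. -/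

import Mathlib

open Matrix Filter Topology
open scoped ComplexOrder

/-! ### Quantum Markov decision processes -/

namespace QMDP

/-- A finite family of `d × d` matrices `E₁, …, E_len` with `∑ Eᵢ† Eᵢ = I`: the Kraus operators of a
trace-preserving super-operator, or the measurement operators of a quantum measurement. -/
structure OpFamily (d : ℕ) where
  len : ℕ
  op : Fin len → Matrix (Fin d) (Fin d) ℂ
  complete : ∑ i, (op i)ᴴ * op i = 1

/-- The super-operator `ρ ↦ ∑ Eᵢ ρ Eᵢ†`. -/
noncomputable def OpFamily.superOp {d : ℕ} (E : OpFamily d) (ρ : Matrix (Fin d) (Fin d) ℂ) :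
    Matrix (Fin d) (Fin d) ℂ :=
  ∑ i, E.op i * ρ * (E.op i)ᴴ

/-- Every operator of the family has the form `a |φ⟩⟨ψ|`. -/
def OpFamily.RankOne {d : ℕ} (E : OpFamily d) : Prop :=
  ∀ i, ∃ (a : ℂ) (φ ψ : Fin d → ℂ), E.op i = a • vecMulVec φ (star ψ)

end QMDP

/-- A quantum Markov decision process `⟨ℂ^dim, Act, 𝐌, Q⟩` with `numAct` actions, given by Kraus
operators, `numMeas` measurements, and availability map `Q = avail`. -/
structure QMDP where
  dim : ℕ
  numAct : ℕ
  numMeas : ℕ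
  act : Fin numAct → QMDP.OpFamily dim
  meas : Fin numMeas → QMDP.OpFamily dim
  avail : Fin numAct ⊕ Fin numMeas → Finset (Fin numAct ⊕ Fin numMeas)

namespace QMDP

/-- The set `Act ∪ 𝐌`. -/
abbrev Choice (M : QMDP) : Type := Fin M.numAct ⊕ Fin M.numMeas

/-- The set `Act ∪ Ω`: actions and pairs (measurement, outcome). -/
abbrev Event (M : QMDP) : Type :=
  Fin M.numAct ⊕ (Σ β : Fin M.numMeas, Fin (M.meas β).len)

/-- The action or measurement that produced an event. -/
def choiceOf (M : QMDP) : M.Event → M.Choice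
  | Sum.inl α => Sum.inl α
  | Sum.inr o => Sum.inr o.1

/-- The operators attached to an action or a measurement. -/
def fam (M : QMDP) : M.Choice → OpFamily M.dim
  | Sum.inl α => M.act α
  | Sum.inr β => M.meas β

/-- A scheduler maps histories in `(Act ∪ Ω)*` to `Act ∪ 𝐌`. Histories are written with the most
recent event at the head of the list. -/
abbrev Scheduler (M : QMDP) : Type := List M.Event → M.Choice

/-- The history can occur under the scheduler: each event comes from the choice made before it. -/
def Consistent (M : QMDP) (S : M.Scheduler) : List M.Event → Prop
  | [] => True
  | e :: w => S w = M.choiceOf e ∧ M.Consistent S w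

/-- The scheduler only makes choices that `Q` makes available after the last event (the first choice
is free). If `Q` is trivial (`avail x = univ` for all `x`), every scheduler is admissible. -/
def Admissible (M : QMDP) (S : M.Scheduler) : Prop :=
  ∀ e w, M.Consistent S (e :: w) → S (e :: w) ∈ M.avail (M.choiceOf e)

/-- Density matrices. -/
def IsDensity {d : ℕ} (ρ : Matrix (Fin d) (Fin d) ℂ) : Prop :=
  ρ.PosSemidef ∧ ρ.trace = 1

/-- The support of a positive semidefinite matrix. -/
noncomputable def supp {d : ℕ} (ρ : Matrix (Fin d) (Fin d) ℂ) :
    Submodule ℂ (EuclideanSpace ℂ (Fin d)) :=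
  LinearMap.range (Matrix.toEuclideanLin ρ)

/-- The matrix of the orthogonal projection `P_B`. -/
noncomputable def projMatrix {d : ℕ} (B : Submodule ℂ (EuclideanSpace ℂ (Fin d))) :
    Matrix (Fin d) (Fin d) ℂ :=
  Matrix.toEuclideanLin.symm
    (B.starProjection : EuclideanSpace ℂ (Fin d) →ₗ[ℂ] EuclideanSpace ℂ (Fin d))

/-- `(ρ_w, p_w)`: the state after the history `w`, and its probability. Histories that do not follow
the scheduler have probability `0`; so have outcomes with `tr (M_m ρ_w M_m†) = 0`, for which the
value of the state is irrelevant. -/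
noncomputable def config (M : QMDP) (S : M.Scheduler) (ρ : Matrix (Fin M.dim) (Fin M.dim) ℂ) :
    List M.Event → Matrix (Fin M.dim) (Fin M.dim) ℂ × ℝ
  | [] => (ρ, 1)
  | Sum.inl α :: w =>
      if S w = Sum.inl α then ((M.act α).superOp (M.config S ρ w).1, (M.config S ρ w).2)
      else (0, 0)
  | Sum.inr ⟨β, j⟩ :: w =>
      if S w = Sum.inr β then
        let σ := (M.meas β).op j * (M.config S ρ w).1 * ((M.meas β).op j)ᴴ
        ((σ.trace)⁻¹ • σ, (M.config S ρ w).2 * σ.trace.re)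
      else (0, 0)

/-- The global state `ρ(n, S) = ∑_{|w| = n} p_w ρ_w`. -/
noncomputable def globalState (M : QMDP) (S : M.Scheduler)
    (ρ : Matrix (Fin M.dim) (Fin M.dim) ℂ) (n : ℕ) : Matrix (Fin M.dim) (Fin M.dim) ℂ :=
  ∑ w : Fin n → M.Event,
    ((M.config S ρ (List.ofFn w)).2 : ℂ) • (M.config S ρ (List.ofFn w)).1

/-- `Pr(ρ(n, S) ⊨ B) = tr (P_B ρ(n, S))`. -/
noncomputable def probAt (M : QMDP) (S : M.Scheduler) (ρ : Matrix (Fin M.dim) (Fin M.dim) ℂ)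
    (B : Submodule ℂ (EuclideanSpace ℂ (Fin M.dim))) (n : ℕ) : ℝ :=
  (projMatrix B * M.globalState S ρ n).trace.re

/-- `Pr^S(ρ ⊨ ◇B) = p`, the reachability probability being the limit of `Pr(ρ(n, S) ⊨ B)`. -/
def HasReachProb (M : QMDP) (S : M.Scheduler) (ρ : Matrix (Fin M.dim) (Fin M.dim) ℂ)
    (B : Submodule ℂ (EuclideanSpace ℂ (Fin M.dim))) (p : ℝ) : Prop :=
  Tendsto (M.probAt S ρ B) atTop (𝓝 p)

/-- `B` is an invariant subspace of `M`. -/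
def Invariant (M : QMDP) (B : Submodule ℂ (EuclideanSpace ℂ (Fin M.dim))) : Prop :=
  (∀ α, ∀ ρ, IsDensity ρ → supp ρ ≤ B → supp ((M.act α).superOp ρ) ≤ B) ∧
  (∀ β j, ∀ ρ, IsDensity ρ → supp ρ ≤ B →
    supp ((M.meas β).op j * ρ * ((M.meas β).op j)ᴴ) ≤ B)

/-- `Pr^S(ρ ⊨ ◇B) = 1` for all schedulers `S` and all initial states `ρ`. -/
def AlwaysReaches (M : QMDP) (B : Submodule ℂ (EuclideanSpace ℂ (Fin M.dim))) : Prop :=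
  ∀ S : M.Scheduler, M.Admissible S → ∀ ρ, IsDensity ρ → M.HasReachProb S ρ B 1

/-- `N = max ({n_α} ∪ {k_β})` (and `0` if there are neither actions nor measurements). -/
def maxLen (M : QMDP) : ℕ := Finset.univ.sup fun x : M.Choice => (M.fam x).len

end QMDP

/-! ### Real random access machines

Programs with finitely many arrays of natural numbers (for indices and flags, with addition and
truncated subtraction) and of real numbers (with exact arithmetic and comparison), under the unit-cost
measure: each constant, array access, arithmetic operation, comparison and assignment is one step.
The only real constants are `0` and `1`, and reals cannot be turned into natural numbers. -/

namespace RealRAM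

/-- Contents of the arrays: `nat a i` is cell `i` of the `a`-th array of natural numbers. -/
structure Store where
  nat : ℕ → ℕ → ℕ
  real : ℕ → ℕ → ℝ

inductive NatExpr where
  | lit (n : ℕ)
  | read (arr : ℕ) (i : NatExpr)
  | add (e f : NatExpr)
  | sub (e f : NatExpr)

inductive RealExpr where
  | zero
  | one
  | read (arr : ℕ) (i : NatExpr)
  | add (x y : RealExpr)
  | sub (x y : RealExpr)
  | mul (x y : RealExpr)
  | div (x y : RealExpr)

inductive Test where
  | natEq (e f : NatExpr)
  | natLt (e f : NatExpr)
  | realEq (x y : RealExpr)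
  | realLt (x y : RealExpr)

inductive Prog where
  | skip
  | setNat (arr : ℕ) (i e : NatExpr)
  | setReal (arr : ℕ) (i : NatExpr) (x : RealExpr)
  | seq (p q : Prog)
  | ite (b : Test) (p q : Prog)
  | while (b : Test) (p : Prog)

def NatExpr.val (s : Store) : NatExpr → ℕ
  | lit n => n
  | read arr i => s.nat arr (i.val s)
  | add e f => e.val s + f.val s
  | sub e f => e.val s - f.val s

def NatExpr.cost : NatExpr → ℕ
  | lit _ => 1
  | read _ i => i.cost + 1
  | add e f => e.cost + f.cost + 1
  | sub e f => e.cost + f.cost + 1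

/-- Division by zero returns zero. -/
noncomputable def RealExpr.val (s : Store) : RealExpr → ℝ
  | zero => 0
  | one => 1
  | read arr i => s.real arr (i.val s)
  | add x y => x.val s + y.val s
  | sub x y => x.val s - y.val s
  | mul x y => x.val s * y.val s
  | div x y => x.val s / y.val s

def RealExpr.cost : RealExpr → ℕ
  | zero => 1
  | one => 1
  | read _ i => i.cost + 1
  | add x y => x.cost + y.cost + 1
  | sub x y => x.cost + y.cost + 1
  | mul x y => x.cost + y.cost + 1
  | div x y => x.cost + y.cost + 1

def Test.holds (s : Store) : Test → Prop
  | natEq e f => e.val s = f.val s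
  | natLt e f => e.val s < f.val s
  | realEq x y => x.val s = y.val s
  | realLt x y => x.val s < y.val s

def Test.cost : Test → ℕ
  | natEq e f => e.cost + f.cost + 1
  | natLt e f => e.cost + f.cost + 1
  | realEq x y => x.cost + y.cost + 1
  | realLt x y => x.cost + y.cost + 1

def Store.setNat (s : Store) (arr i v : ℕ) : Store :=
  { s with nat := Function.update s.nat arr (Function.update (s.nat arr) i v) }

def Store.setReal (s : Store) (arr i : ℕ) (v : ℝ) : Store :=
  { s with real := Function.update s.real arr (Function.update (s.real arr) i v) }

/-- `Exec p s s' t`: started in `s`, the program `p` halts in `s'` after `t` steps. -/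
inductive Exec : Prog → Store → Store → ℕ → Prop
  | skip (s : Store) : Exec Prog.skip s s 1
  | setNat (arr : ℕ) (i e : NatExpr) (s : Store) :
      Exec (Prog.setNat arr i e) s (s.setNat arr (i.val s) (e.val s)) (i.cost + e.cost + 1)
  | setReal (arr : ℕ) (i : NatExpr) (x : RealExpr) (s : Store) :
      Exec (Prog.setReal arr i x) s (s.setReal arr (i.val s) (x.val s)) (i.cost + x.cost + 1)
  | seq {p q : Prog} {s s₁ s₂ : Store} {t₁ t₂ : ℕ} :
      Exec p s s₁ t₁ → Exec q s₁ s₂ t₂ → Exec (Prog.seq p q) s s₂ (t₁ + t₂)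
  | ite_true {b : Test} {p q : Prog} {s s' : Store} {t : ℕ} :
      b.holds s → Exec p s s' t → Exec (Prog.ite b p q) s s' (b.cost + t)
  | ite_false {b : Test} {p q : Prog} {s s' : Store} {t : ℕ} :
      ¬ b.holds s → Exec q s s' t → Exec (Prog.ite b p q) s s' (b.cost + t)
  | while_true {b : Test} {p : Prog} {s s₁ s₂ : Store} {t₁ t₂ : ℕ} :
      b.holds s → Exec p s s₁ t₁ → Exec (Prog.while b p) s₁ s₂ t₂ →
      Exec (Prog.while b p) s s₂ (b.cost + t₁ + t₂)
  | while_false {b : Test} {p : Prog} {s : Store} :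
      ¬ b.holds s → Exec (Prog.while b p) s s b.cost

/-- Started in `s`, the program halts within `T` steps and answers whether `P` holds: cell `0` of
the natural number array `0` ends up being `1` if `P` is true and `0` if `P` is false. -/
def DecidesWithin (p : Prog) (s : Store) (P : Prop) (T : ℕ) : Prop :=
  ∃ (s' : Store) (t : ℕ), Exec p s s' t ∧ t ≤ T ∧
    (P → s'.nat 0 0 = 1) ∧ (¬ P → s'.nat 0 0 = 0)

end RealRAM

/-! ### The input of the decision problem -/

namespace QMDP

/-- `Act ∪ 𝐌` as a list, the actions first. -/
def choices (M : QMDP) : List M.Choice :=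
  (List.finRange M.numAct).map Sum.inl ++ (List.finRange M.numMeas).map Sum.inr

/-- The entries of a matrix, row by row, each as real part followed by imaginary part. -/
def matrixEntries {d : ℕ} (A : Matrix (Fin d) (Fin d) ℂ) : List ℝ :=
  (List.finRange d).flatMap fun r => (List.finRange d).flatMap fun c => [(A r c).re, (A r c).im]

/-- The initial store for the input `(M, B)`. Natural number arrays: `1` holds `dim`, `|Act|`,
`|𝐌|`; `2` holds the numbers of operators `n_α` and `k_β`; `3` holds the table of `Q`. Real arrays:
`0` holds the matrix of `P_B`, `1` holds all the operators, family after family. All other cells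
are `0`. -/
noncomputable def inputStore (M : QMDP) (B : Submodule ℂ (EuclideanSpace ℂ (Fin M.dim))) :
    RealRAM.Store where
  nat arr i := match arr with
    | 1 => [M.dim, M.numAct, M.numMeas].getD i 0
    | 2 => (M.choices.map fun x => (M.fam x).len).getD i 0
    | 3 => (M.choices.flatMap fun x =>
        M.choices.map fun y => if y ∈ M.avail x then 1 else 0).getD i 0
    | _ => 0
  real arr i := match arr with
    | 0 => (matrixEntries (projMatrix B)).getD i 0
    | 1 => (M.choices.flatMap fun x =>
        (List.finRange (M.fam x).len).flatMap fun k => matrixEntries ((M.fam x).op k)).getD i 0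
    | _ => 0

end QMDP

/-!
As all operators have rank one, after the operator `A` has acted the state is a multiple of `A A†`,
whatever it was before. So all that matters about a history is which operators can have acted last:
a set of operators of the last choice. There are at most `(|Act| + |𝐌|) 2 ^ N` such sets, and
whether `B` can be avoided for `n` steps from each of them is computed by dynamic programming on
`n`; the answers no longer change once `n` is the number of sets, so that they then tell whether `B`
can be avoided forever.

If `B` can be avoided forever from `{A}` for some `A ≠ 0`, then a scheduler that starts with the
choice of `A` misses `B` with a positive probability. Otherwise `B` cannot be avoided for `n` steps,
for one `n` that works for all nonzero operators. In the dual picture there are only finitely many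
observables into which `1 - P_B` can turn within `n` steps, so that the probability of having missed
`B` shrinks by a constant factor smaller than `1` every `n + 1` steps. By invariance nothing that
has reached `B` leaves it, and so the probability of missing `B` tends to zero.

The time is polynomial since completeness of rank-one operators forces `dim ≤ N`, while the table
and the number of rounds have size at most `(|Act| + |𝐌|) 2 ^ N`. The entry for a set of operators
is given by a fixed formula with quantifiers and sums over ranges of this size.
-/

namespace RealRAM

/-! ### Running times of programs -/

/-- A total-correctness triple with a time bound: started in `s`, the program `p` halts within `T`
steps in a store satisfying `Q`. -/
def Runs (p : Prog) (s : Store) (T : ℕ) (Q : Store → Prop) : Prop :=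
  ∃ s' t, Exec p s s' t ∧ t ≤ T ∧ Q s'

namespace Runs

variable {p q : Prog} {b : Test} {s : Store} {T T₁ T₂ : ℕ} {Q R : Store → Prop}

theorem mono (h : Runs p s T₁ Q) (hT : T₁ ≤ T₂) (hQ : ∀ s', Q s' → R s') : Runs p s T₂ R := by
  obtain ⟨s', t, hexec, ht, hs'⟩ := h
  exact ⟨s', t, hexec, ht.trans hT, hQ _ hs'⟩

theorem mono_time (h : Runs p s T₁ Q) (hT : T₁ ≤ T₂) : Runs p s T₂ Q :=
  h.mono hT fun _ => id

theorem setNat {arr : ℕ} {i e : NatExpr} (h : Q (s.setNat arr (i.val s) (e.val s))) :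
    Runs (.setNat arr i e) s (i.cost + e.cost + 1) Q :=
  ⟨_, _, .setNat arr i e s, le_rfl, h⟩

theorem setReal {arr : ℕ} {i : NatExpr} {x : RealExpr}
    (h : Q (s.setReal arr (i.val s) (x.val s))) :
    Runs (.setReal arr i x) s (i.cost + x.cost + 1) Q :=
  ⟨_, _, .setReal arr i x s, le_rfl, h⟩

theorem seq (hp : Runs p s T₁ Q) (hq : ∀ s', Q s' → Runs q s' T₂ R) :
    Runs (.seq p q) s (T₁ + T₂) R := by
  obtain ⟨s₁, t₁, hexec₁, ht₁, hs₁⟩ := hp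
  obtain ⟨s₂, t₂, hexec₂, ht₂, hs₂⟩ := hq s₁ hs₁
  exact ⟨s₂, _, .seq hexec₁ hexec₂, Nat.add_le_add ht₁ ht₂, hs₂⟩

theorem setNat_seq {arr : ℕ} {i e : NatExpr}
    (h : Runs p (s.setNat arr (i.val s) (e.val s)) T Q) :
    Runs (.seq (.setNat arr i e) p) s (i.cost + e.cost + 1 + T) Q :=
  (setNat (Q := (· = _)) rfl).seq fun _ hs => hs ▸ h

theorem setReal_seq {arr : ℕ} {i : NatExpr} {x : RealExpr}
    (h : Runs p (s.setReal arr (i.val s) (x.val s)) T Q) :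
    Runs (.seq (.setReal arr i x) p) s (i.cost + x.cost + 1 + T) Q :=
  (setReal (Q := (· = _)) rfl).seq fun _ hs => hs ▸ h

theorem ite (hp : b.holds s → Runs p s T Q) (hq : ¬ b.holds s → Runs q s T Q) :
    Runs (.ite b p q) s (b.cost + T) Q := by
  by_cases hb : b.holds s
  · obtain ⟨s', t, hexec, ht, hs'⟩ := hp hb
    exact ⟨s', _, .ite_true hb hexec, Nat.add_le_add_left ht _, hs'⟩
  · obtain ⟨s', t, hexec, ht, hs'⟩ := hq hb
    exact ⟨s', _, .ite_false hb hexec, Nat.add_le_add_left ht _, hs'⟩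

theorem while_loop {n : ℕ} (I : ℕ → Store → Prop)
    (hb : ∀ i ≤ n, ∀ s, I i s → (b.holds s ↔ i < n))
    (hp : ∀ i < n, ∀ s, I i s → Runs p s T (I (i + 1))) (h0 : I 0 s) :
    Runs (.while b p) s (n * (b.cost + T) + b.cost) (I n) := by
  suffices H : ∀ m i s, i + m = n → I i s →
      Runs (.while b p) s (m * (b.cost + T) + b.cost) (I n) from H n 0 s (zero_add n) h0
  intro m
  induction m with
  | zero =>
    rintro i s rfl hs
    exact ⟨s, _, .while_false (by simp [hb i le_rfl s hs]), by simp, hs⟩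
  | succ m ih =>
    intro i s hi hs
    obtain ⟨s₁, t₁, hexec₁, ht₁, hs₁⟩ := hp i (by omega) s hs
    obtain ⟨s₂, t₂, hexec₂, ht₂, hs₂⟩ := ih (i + 1) s₁ (by omega) hs₁
    refine ⟨s₂, _, .while_true ((hb i (by omega) s hs).2 (by omega)) hexec₁ hexec₂, ?_, hs₂⟩
    rw [Nat.succ_mul]
    omega

end Runs

namespace Store

@[simp] theorem setNat_nat (s : Store) (a i v b : ℕ) :
    (s.setNat a i v).nat b = if b = a then Function.update (s.nat a) i v else s.nat b :=
  Function.update_apply ..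

@[simp] theorem setNat_real (s : Store) (a i v : ℕ) : (s.setNat a i v).real = s.real := rfl

@[simp] theorem setReal_nat (s : Store) (a i : ℕ) (v : ℝ) : (s.setReal a i v).nat = s.nat := rfl

@[simp] theorem setReal_real (s : Store) (a i : ℕ) (v : ℝ) (b : ℕ) :
    (s.setReal a i v).real b = if b = a then Function.update (s.real a) i v else s.real b :=
  Function.update_apply ..

theorem setNat_eq_self (s : Store) (a i : ℕ) : s.setNat a i (s.nat a i) = s := by
  simp [setNat]

end Store

/-- The loop `for c := 0, …, b - 1 do p`, whose counter is cell `c` of array `arr`; the bound `b` is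
evaluated again in every round. -/
def forLoop (arr c : ℕ) (b : NatExpr) (p : Prog) : Prog :=
  .seq (.setNat arr (.lit c) (.lit 0)) <|
  .while (.natLt (.read arr (.lit c)) b) <|
  .seq p (.setNat arr (.lit c) (.add (.read arr (.lit c)) (.lit 1)))

theorem Runs.forLoop {arr c n T : ℕ} {b : NatExpr} {p : Prog} {s : Store}
    (I : ℕ → Store → Prop) (hb : ∀ i s, I i s → b.val s = n) (h0 : I 0 (s.setNat arr c 0))
    (hp : ∀ i < n, ∀ s, s.nat arr c = i → I i s →
      Runs p s T fun s' => s'.nat arr c = i ∧ I (i + 1) (s'.setNat arr c (i + 1))) :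
    Runs (forLoop arr c b p) s (n * (T + b.cost + 9) + b.cost + 6) (I n) := by
  have hwhile := Runs.while_loop (b := .natLt (.read arr (.lit c)) b) (n := n)
    (fun i s => s.nat arr c = i ∧ I i s)
    (fun i _ s hs => by simp [Test.holds, NatExpr.val, hs.1, hb i s hs.2])
    (fun i hi s hs => (hp i hi s hs.1 hs.2).seq fun s' hs' =>
      Runs.setNat (arr := arr) (i := .lit c) (e := .add (.read arr (.lit c)) (.lit 1))
        ⟨by simp [NatExpr.val, hs'.1], by simpa [NatExpr.val, hs'.1] using hs'.2⟩)
    ⟨by simp, h0⟩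
  refine (setNat_seq hwhile).mono ?_ fun _ hs => hs.2
  simp only [NatExpr.cost, Test.cost]
  apply le_of_eq
  ring

/-! ### Terms with bounded sums -/

mutual
/-- Terms for natural numbers, in which numbered variables, read-only tables, and sums over a range
of numbers may occur. In `sum x r b` the variable `x` runs through the numbers below `r`, and
`nonzero x` is `1` or `0` according to whether the real number `x` differs from zero. -/
inductive NatTerm where
  | lit (n : ℕ)
  | var (x : ℕ)
  | read (a : Fin 4) (e : NatTerm)
  | add (e f : NatTerm)
  | sub (e f : NatTerm)
  | sum (x : ℕ) (r b : NatTerm)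
  | nonzero (x : RealTerm)
/-- Terms for real numbers, with the same kinds of variables, tables and sums. -/
inductive RealTerm where
  | read (a : Fin 2) (e : NatTerm)
  | add (x y : RealTerm)
  | sub (x y : RealTerm)
  | mul (x y : RealTerm)
  | sum (x : ℕ) (r : NatTerm) (b : RealTerm)
end

/-- The read-only tables to which terms refer. -/
structure Tables where
  nat : Fin 4 → ℕ → ℕ
  real : Fin 2 → ℕ → ℝ

/-- The bound, stored in cell `3` of table `0`, at which the ranges of all sums are cut off; this
makes the evaluation of every fixed term polynomial in the bound. -/
abbrev Tables.bound (G : Tables) : ℕ := G.nat 0 3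

open Classical in
mutual
/-- The value of a term when the variables have the values `v`. -/
noncomputable def NatTerm.eval (G : Tables) (v : ℕ → ℕ) : NatTerm → ℕ
  | .lit n => n
  | .var x => v x
  | .read a e => G.nat a (e.eval G v)
  | .add e f => e.eval G v + f.eval G v
  | .sub e f => e.eval G v - f.eval G v
  | .sum x r b =>
      ∑ i ∈ Finset.range (min (r.eval G v) G.bound), b.eval G (Function.update v x i)
  | .nonzero x => if x.eval G v = 0 then 0 else 1
/-- The value of a real term when the variables have the values `v`. -/
noncomputable def RealTerm.eval (G : Tables) (v : ℕ → ℕ) : RealTerm → ℝ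
  | .read a e => G.real a (e.eval G v)
  | .add x y => x.eval G v + y.eval G v
  | .sub x y => x.eval G v - y.eval G v
  | .mul x y => x.eval G v * y.eval G v
  | .sum x r b =>
      ∑ i ∈ Finset.range (min (r.eval G v) G.bound), b.eval G (Function.update v x i)
end

/-! ### Compilation of terms

Terms are evaluated on two stacks, the natural number array `0` and the real array `2`. Natural
number array `5` holds the variables, and tables `a` of natural and real numbers are the natural
number arrays `a + 1` and the real arrays `a`. -/

/-- The store holds the given tables and values of the variables. -/
structure Represents (s : Store) (G : Tables) (v : ℕ → ℕ) : Prop where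
  var : s.nat 5 = v
  nat : ∀ a : Fin 4, s.nat (a + 1) = G.nat a
  real : ∀ a : Fin 2, s.real a = G.real a

/-- `s'` differs from `s` at most on the two stacks, from cell `k` on. -/
structure SameBelow (k : ℕ) (s s' : Store) : Prop where
  nat : ∀ a ≠ 0, s'.nat a = s.nat a
  stack : ∀ j < k, s'.nat 0 j = s.nat 0 j
  real : ∀ a ≠ 2, s'.real a = s.real a
  realStack : ∀ j < k, s'.real 2 j = s.real 2 j

namespace SameBelow

variable {k j : ℕ} {s s' s'' : Store}

theorem refl (k : ℕ) (s : Store) : SameBelow k s s :=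
  ⟨fun _ _ => rfl, fun _ _ => rfl, fun _ _ => rfl, fun _ _ => rfl⟩

theorem trans (h : SameBelow k s s') (h' : SameBelow k s' s'') : SameBelow k s s'' :=
  ⟨fun a ha => (h'.nat a ha).trans (h.nat a ha), fun j hj => (h'.stack j hj).trans (h.stack j hj),
    fun a ha => (h'.real a ha).trans (h.real a ha),
    fun j hj => (h'.realStack j hj).trans (h.realStack j hj)⟩

theorem of_le (h : SameBelow j s s') (hk : k ≤ j) : SameBelow k s s' :=
  ⟨h.nat, fun i hi => h.stack i (hi.trans_le hk), h.real,
    fun i hi => h.realStack i (hi.trans_le hk)⟩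

theorem setNat (h : SameBelow k s s') (hj : k ≤ j) (n : ℕ) :
    SameBelow k s (s'.setNat 0 j n) := by
  refine ⟨fun a ha => ?_, fun i hi => ?_, h.real, h.realStack⟩
  · simpa [ha] using h.nat a ha
  · simpa [(hi.trans_le hj).ne] using h.stack i hi

theorem setReal (h : SameBelow k s s') (hj : k ≤ j) (x : ℝ) :
    SameBelow k s (s'.setReal 2 j x) := by
  refine ⟨h.nat, h.stack, fun a ha => ?_, fun i hi => ?_⟩
  · simpa [ha] using h.real a ha
  · simpa [(hi.trans_le hj).ne] using h.realStack i hi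

theorem setVar {x m : ℕ} (h : SameBelow k (s.setNat 5 x m) s') (n : ℕ) :
    SameBelow k (s.setNat 5 x n) (s'.setNat 5 x n) := by
  refine ⟨fun a ha => ?_, by simpa using h.stack, by simpa using h.real, by simpa using h.realStack⟩
  have hnat := h.nat a ha
  obtain rfl | ha' := eq_or_ne a 5
  · simp only [Store.setNat_nat, if_true] at hnat ⊢
    simp [hnat]
  · simpa [ha'] using hnat

theorem represents {G : Tables} {v : ℕ → ℕ} (h : SameBelow k s s') (hs : Represents s G v) :
    Represents s' G v :=
  ⟨(h.nat 5 (by decide)).trans hs.var, fun a => (h.nat _ (Nat.succ_ne_zero _)).trans (hs.nat a),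
    fun a => (h.real _ a.2.ne).trans (hs.real a)⟩

end SameBelow

theorem Represents.setVar {s : Store} {G : Tables} {v : ℕ → ℕ} (h : Represents s G v) (x i : ℕ) :
    Represents (s.setNat 5 x i) G (Function.update v x i) :=
  ⟨by simp [h.var], fun a => by
    have : (a : ℕ) ≠ 4 := a.2.ne
    simp [this, h.nat], h.real⟩

theorem Represents.bound_eq {s : Store} {G : Tables} {v : ℕ → ℕ} (h : Represents s G v) :
    s.nat 1 3 = G.bound :=
  congrFun (h.nat 0) 3

/-- Cell `k` of the stack. -/
abbrev stackCell (k : ℕ) : NatExpr := .read 0 (.lit k)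

/-- Cell `k` of the real stack. -/
abbrev realStackCell (k : ℕ) : RealExpr := .read 2 (.lit k)

/-- The cell that holds `Tables.bound`. -/
abbrev boundCell : NatExpr := .read 1 (.lit 3)

/-- The minimum of two expressions, by means of truncated subtraction. -/
abbrev minExpr (e f : NatExpr) : NatExpr := .sub e (.sub e f)

/-- The loop of a sum over the variable `x`, whose range is in cell `k` of the stack; cell `k + 1`
saves the variable. -/
def sumLoop (k x : ℕ) (p : Prog) : Prog :=
  .seq (.setNat 0 (.lit (k + 1)) (.read 5 (.lit x))) <|
  .seq (forLoop 5 x (minExpr (stackCell k) boundCell) p) <|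
  .setNat 5 (.lit x) (stackCell (k + 1))

mutual
/-- Code that leaves the value of the term in cell `k` of the stack. -/
def NatTerm.comp (k : ℕ) : NatTerm → Prog
  | .lit n => .setNat 0 (.lit k) (.lit n)
  | .var x => .setNat 0 (.lit k) (.read 5 (.lit x))
  | .read a e => .seq (e.comp k) (.setNat 0 (.lit k) (.read (a + 1) (stackCell k)))
  | .add e f => .seq (e.comp k) <| .seq (f.comp (k + 1)) <|
      .setNat 0 (.lit k) (.add (stackCell k) (stackCell (k + 1)))
  | .sub e f => .seq (e.comp k) <| .seq (f.comp (k + 1)) <|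
      .setNat 0 (.lit k) (.sub (stackCell k) (stackCell (k + 1)))
  | .sum x r b => .seq (r.comp k) <| .seq (.setNat 0 (.lit (k + 2)) (.lit 0)) <|
      .seq (sumLoop k x <| .seq (b.comp (k + 3)) <|
        .setNat 0 (.lit (k + 2)) (.add (stackCell (k + 2)) (stackCell (k + 3)))) <|
      .setNat 0 (.lit k) (stackCell (k + 2))
  | .nonzero x => .seq (x.comp k) <| .ite (.realEq (realStackCell k) .zero)
      (.setNat 0 (.lit k) (.lit 0)) (.setNat 0 (.lit k) (.lit 1))
/-- Code that leaves the value of the term in cell `k` of the real stack. -/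
def RealTerm.comp (k : ℕ) : RealTerm → Prog
  | .read a e => .seq (e.comp k) (.setReal 2 (.lit k) (.read a (stackCell k)))
  | .add x y => .seq (x.comp k) <| .seq (y.comp (k + 1)) <|
      .setReal 2 (.lit k) (.add (realStackCell k) (realStackCell (k + 1)))
  | .sub x y => .seq (x.comp k) <| .seq (y.comp (k + 1)) <|
      .setReal 2 (.lit k) (.sub (realStackCell k) (realStackCell (k + 1)))
  | .mul x y => .seq (x.comp k) <| .seq (y.comp (k + 1)) <|
      .setReal 2 (.lit k) (.mul (realStackCell k) (realStackCell (k + 1)))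
  | .sum x r b => .seq (r.comp k) <| .seq (.setReal 2 (.lit (k + 2)) .zero) <|
      .seq (sumLoop k x <| .seq (b.comp (k + 3)) <|
        .setReal 2 (.lit (k + 2)) (.add (realStackCell (k + 2)) (realStackCell (k + 3)))) <|
      .setReal 2 (.lit k) (realStackCell (k + 2))
end

mutual
/-- A bound for the running time of `NatTerm.comp`, as a polynomial in `Tables.bound`. -/
noncomputable def NatTerm.time : NatTerm → Polynomial ℕ
  | .lit _ => 3
  | .var _ => 4
  | .read _ e => e.time + 5
  | .add e f => e.time + f.time + 7
  | .sub e f => e.time + f.time + 7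
  | .sum _ r b => r.time + Polynomial.X * (b.time + 24) + 30
  | .nonzero x => x.time + 7
/-- A bound for the running time of `RealTerm.comp`, as a polynomial in `Tables.bound`. -/
noncomputable def RealTerm.time : RealTerm → Polynomial ℕ
  | .read _ e => e.time + 5
  | .add x y => x.time + y.time + 7
  | .sub x y => x.time + y.time + 7
  | .mul x y => x.time + y.time + 7
  | .sum _ r b => r.time + Polynomial.X * (b.time + 24) + 30
end

/-- Whenever the store holds the given tables and variables, the program leaves `n` in cell `k` of
the stack within `T` steps, and uses only the stacks from cell `k` on. -/
def ComputesNat (G : Tables) (v : ℕ → ℕ) (k : ℕ) (p : Prog) (T n : ℕ) : Prop :=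
  ∀ s, Represents s G v → Runs p s T fun s' => s'.nat 0 k = n ∧ SameBelow k s s'

/-- The analogue of `ComputesNat` for a result in cell `k` of the real stack. -/
def ComputesReal (G : Tables) (v : ℕ → ℕ) (k : ℕ) (p : Prog) (T : ℕ) (x : ℝ) : Prop :=
  ∀ s, Represents s G v → Runs p s T fun s' => s'.real 2 k = x ∧ SameBelow k s s'

section Compilation

variable {G : Tables} {v : ℕ → ℕ} {k T T₁ T₂ : ℕ} {p q : Prog}

theorem ComputesNat.setNat {e : NatExpr} {n : ℕ} (he : ∀ s, Represents s G v → e.val s = n) :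
    ComputesNat G v k (.setNat 0 (.lit k) e) (e.cost + 2) n := fun s hs =>
  (Runs.setNat ⟨by simp [NatExpr.val, he s hs], (SameBelow.refl k s).setNat le_rfl _⟩).mono_time
    (by simp only [NatExpr.cost]; omega)

theorem ComputesNat.seq_setNat {e : NatExpr} {m n : ℕ} (hp : ComputesNat G v k p T m)
    (he : ∀ s, Represents s G v → s.nat 0 k = m → e.val s = n) :
    ComputesNat G v k (.seq p (.setNat 0 (.lit k) e)) (T + (e.cost + 2)) n := fun s hs =>
  ((hp s hs).seq fun _ ⟨hval, hsame⟩ => Runs.setNat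
    ⟨by simp [NatExpr.val, he _ (hsame.represents hs) hval], hsame.setNat le_rfl _⟩).mono_time
    (by simp only [NatExpr.cost]; omega)

theorem ComputesNat.seq_seq_setNat {e : NatExpr} {m₁ m₂ n : ℕ} (hp : ComputesNat G v k p T₁ m₁)
    (hq : ComputesNat G v (k + 1) q T₂ m₂)
    (he : ∀ s, s.nat 0 k = m₁ → s.nat 0 (k + 1) = m₂ → e.val s = n) :
    ComputesNat G v k (.seq p (.seq q (.setNat 0 (.lit k) e))) (T₁ + T₂ + (e.cost + 2)) n :=
  fun s hs => ((hp s hs).seq fun s₁ ⟨hval₁, hsame₁⟩ =>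
    (hq s₁ (hsame₁.represents hs)).seq fun _ ⟨hval₂, hsame₂⟩ => Runs.setNat
      ⟨by simp [NatExpr.val, he _ ((hsame₂.stack k k.lt_succ_self).trans hval₁) hval₂],
        (hsame₁.trans (hsame₂.of_le k.le_succ)).setNat le_rfl _⟩).mono_time
    (by simp only [NatExpr.cost]; omega)

theorem ComputesNat.seq_setReal {e : RealExpr} {n : ℕ} {x : ℝ} (hp : ComputesNat G v k p T n)
    (he : ∀ s, Represents s G v → s.nat 0 k = n → e.val s = x) :
    ComputesReal G v k (.seq p (.setReal 2 (.lit k) e)) (T + (e.cost + 2)) x := fun s hs =>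
  ((hp s hs).seq fun _ ⟨hval, hsame⟩ => Runs.setReal
    ⟨by simp [NatExpr.val, he _ (hsame.represents hs) hval], hsame.setReal le_rfl _⟩).mono_time
    (by simp only [NatExpr.cost]; omega)

theorem ComputesReal.seq_seq_setReal {e : RealExpr} {x₁ x₂ y : ℝ}
    (hp : ComputesReal G v k p T₁ x₁) (hq : ComputesReal G v (k + 1) q T₂ x₂)
    (he : ∀ s, s.real 2 k = x₁ → s.real 2 (k + 1) = x₂ → e.val s = y) :
    ComputesReal G v k (.seq p (.seq q (.setReal 2 (.lit k) e))) (T₁ + T₂ + (e.cost + 2)) y :=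
  fun s hs => ((hp s hs).seq fun s₁ ⟨hval₁, hsame₁⟩ =>
    (hq s₁ (hsame₁.represents hs)).seq fun _ ⟨hval₂, hsame₂⟩ => Runs.setReal
      ⟨by simp [NatExpr.val, he _ ((hsame₂.realStack k k.lt_succ_self).trans hval₁) hval₂],
        (hsame₁.trans (hsame₂.of_le k.le_succ)).setReal le_rfl _⟩).mono_time
    (by simp only [NatExpr.cost]; omega)

open Classical in
theorem ComputesReal.seq_ite {x : ℝ} (hp : ComputesReal G v k p T x) :
    ComputesNat G v k (.seq p <| .ite (.realEq (realStackCell k) .zero)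
      (.setNat 0 (.lit k) (.lit 0)) (.setNat 0 (.lit k) (.lit 1))) (T + 7)
      (if x = 0 then 0 else 1) := fun s hs =>
  (hp s hs).seq fun _ ⟨hval, hsame⟩ => Runs.ite
    (fun hx => Runs.setNat ⟨by simp_all [Test.holds, NatExpr.val, RealExpr.val],
      hsame.setNat le_rfl _⟩)
    (fun hx => Runs.setNat ⟨by simp_all [Test.holds, NatExpr.val, RealExpr.val],
      hsame.setNat le_rfl _⟩)

theorem runs_forLoop_var {x n : ℕ} {s : Store} (hs : Represents s G v) (hn : s.nat 0 k = n)
    (J : ℕ → ℕ → ℝ → Prop) (h0 : J 0 (s.nat 0 (k + 2)) (s.real 2 (k + 2)))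
    (hp : ∀ i s, Represents s G (Function.update v x i) → J i (s.nat 0 (k + 2)) (s.real 2 (k + 2)) →
      Runs p s T fun s' =>
        J (i + 1) (s'.nat 0 (k + 2)) (s'.real 2 (k + 2)) ∧ SameBelow (k + 2) s s') :
    Runs (forLoop 5 x (minExpr (stackCell k) boundCell) p) s (G.bound * (T + 17) + 14) fun s' =>
      J (min n G.bound) (s'.nat 0 (k + 2)) (s'.real 2 (k + 2)) ∧
        SameBelow (k + 2) (s.setNat 5 x (min n G.bound)) s' := by
  let I : ℕ → Store → Prop := fun i s₁ =>
    J i (s₁.nat 0 (k + 2)) (s₁.real 2 (k + 2)) ∧ SameBelow (k + 2) (s.setNat 5 x i) s₁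
  have hrange : ∀ i s₁, I i s₁ → (minExpr (stackCell k) boundCell).val s₁ = min n G.bound := by
    rintro i s₁ ⟨-, h⟩
    have hcell : s₁.nat 0 k = n := by simpa [hn] using h.stack k (by omega)
    simp only [NatExpr.val, hcell, (h.represents (hs.setVar x i)).bound_eq]
    omega
  refine (Runs.forLoop (T := T) I hrange ⟨by simpa using h0, .refl _ _⟩
    fun i _ s₁ hx ⟨hJ, h⟩ => ?_).mono_time ?_
  · refine (hp i s₁ (h.represents (hs.setVar x i)) hJ).mono le_rfl
      fun s₂ ⟨hJ', h'⟩ => ⟨?_, by simpa using hJ', (h.trans h').setVar (i + 1)⟩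
    rw [h'.nat 5 (by decide), hx]
  · simp only [NatExpr.cost]
    nlinarith [Nat.mul_le_mul_right (T + 17) (min_le_right n G.bound)]

theorem runs_sumLoop {x n : ℕ} {s : Store} (hs : Represents s G v) (hn : s.nat 0 k = n)
    (J : ℕ → ℕ → ℝ → Prop) (h0 : J 0 (s.nat 0 (k + 2)) (s.real 2 (k + 2)))
    (hp : ∀ i s, Represents s G (Function.update v x i) → J i (s.nat 0 (k + 2)) (s.real 2 (k + 2)) →
      Runs p s T fun s' =>
        J (i + 1) (s'.nat 0 (k + 2)) (s'.real 2 (k + 2)) ∧ SameBelow (k + 2) s s') :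
    Runs (sumLoop k x p) s (G.bound * (T + 17) + 22) fun s' =>
      J (min n G.bound) (s'.nat 0 (k + 2)) (s'.real 2 (k + 2)) ∧ SameBelow k s s' := by
  have hsave : SameBelow k s (s.setNat 0 (k + 1) (v x)) :=
    (SameBelow.refl k s).setNat k.le_succ _
  have hloop := runs_forLoop_var (s := s.setNat 0 (k + 1) (v x)) (hsave.represents hs)
    (by simpa using hn) J (by simpa using h0) hp
  have hrestore : (s.setNat 0 (k + 1) (v x)).setNat 5 x (v x) = s.setNat 0 (k + 1) (v x) := by
    have hvar := congrFun (hsave.represents hs).var x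
    nth_rw 2 [← hvar]
    exact Store.setNat_eq_self ..
  have hloop_restore := hloop.seq (T₂ := 4) (q := .setNat 5 (.lit x) (stackCell (k + 1)))
    (R := fun s' => J (min n G.bound) (s'.nat 0 (k + 2)) (s'.real 2 (k + 2)) ∧ SameBelow k s s')
    fun s₁ ⟨hJ, h⟩ => Runs.setNat ⟨by simpa using hJ, by
      have hsaved : s₁.nat 0 (k + 1) = v x := by simpa using h.stack (k + 1) (by omega)
      simp only [NatExpr.val, hsaved]
      exact hsave.trans (hrestore ▸ (h.setVar (v x)).of_le (by omega))⟩
  refine (Runs.setNat_seq (T := G.bound * (T + 17) + 14 + 4) ?_).mono_time ?_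
  · simpa only [NatExpr.val, hs.var] using hloop_restore
  · simp only [NatExpr.cost]
    omega

theorem ComputesNat.sum {x n : ℕ} {f : ℕ → ℕ} (hp : ComputesNat G v k p T₁ n)
    (hq : ∀ i, ComputesNat G (Function.update v x i) (k + 3) q T₂ (f i)) :
    ComputesNat G v k (.seq p <| .seq (.setNat 0 (.lit (k + 2)) (.lit 0)) <|
      .seq (sumLoop k x <| .seq q <|
        .setNat 0 (.lit (k + 2)) (.add (stackCell (k + 2)) (stackCell (k + 3)))) <|
      .setNat 0 (.lit k) (stackCell (k + 2))) (T₁ + G.bound * (T₂ + 24) + 30)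
      (∑ i ∈ Finset.range (min n G.bound), f i) := by
  intro s hs
  refine ((hp s hs).seq fun s₁ ⟨hn, hsame⟩ =>
    Runs.setNat_seq (T := G.bound * (T₂ + 24) + 26) ?_).mono_time ?_
  · have hstart : SameBelow k s (s₁.setNat 0 (k + 2) 0) := hsame.setNat (by omega) _
    refine ((runs_sumLoop (T := T₂ + 7) (n := n) (hstart.represents hs) (by simpa using hn)
      (fun i m _ => m = ∑ j ∈ Finset.range i, f j) (by simp) fun i s₂ hs₂ hJ => ?_).seq
      fun s₂ ⟨hJ, hsame₂⟩ => Runs.setNat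
        ⟨by simpa [NatExpr.val] using hJ, (hstart.trans hsame₂).setNat le_rfl _⟩).mono_time ?_
    · refine ((hq i s₂ hs₂).seq fun s₃ ⟨hval, hsame₃⟩ => Runs.setNat
        ⟨?_, (hsame₃.of_le (Nat.le_succ _)).setNat le_rfl _⟩)
      simp [NatExpr.val, hval, hsame₃.stack (k + 2) (by omega), hJ, Finset.sum_range_succ]
    · simp only [NatExpr.cost]
      nlinarith
  · simp only [NatExpr.cost]
    nlinarith

theorem ComputesReal.sum {x n : ℕ} {f : ℕ → ℝ} (hp : ComputesNat G v k p T₁ n)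
    (hq : ∀ i, ComputesReal G (Function.update v x i) (k + 3) q T₂ (f i)) :
    ComputesReal G v k (.seq p <| .seq (.setReal 2 (.lit (k + 2)) .zero) <|
      .seq (sumLoop k x <| .seq q <|
        .setReal 2 (.lit (k + 2)) (.add (realStackCell (k + 2)) (realStackCell (k + 3)))) <|
      .setReal 2 (.lit k) (realStackCell (k + 2))) (T₁ + G.bound * (T₂ + 24) + 30)
      (∑ i ∈ Finset.range (min n G.bound), f i) := by
  intro s hs
  refine ((hp s hs).seq fun s₁ ⟨hn, hsame⟩ =>
    Runs.setReal_seq (T := G.bound * (T₂ + 24) + 26) ?_).mono_time ?_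
  · have hstart : SameBelow k s (s₁.setReal 2 (k + 2) 0) := hsame.setReal (by omega) _
    refine ((runs_sumLoop (T := T₂ + 7) (n := n) (hstart.represents hs) (by simpa using hn)
      (fun i _ y => y = ∑ j ∈ Finset.range i, f j) (by simp) fun i s₂ hs₂ hJ => ?_).seq
      fun s₂ ⟨hJ, hsame₂⟩ => Runs.setReal
        ⟨by simpa [NatExpr.val, RealExpr.val] using hJ,
          (hstart.trans hsame₂).setReal le_rfl _⟩).mono_time ?_
    · refine ((hq i s₂ hs₂).seq fun s₃ ⟨hval, hsame₃⟩ => Runs.setReal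
        ⟨?_, (hsame₃.of_le (Nat.le_succ _)).setReal le_rfl _⟩)
      simp [NatExpr.val, RealExpr.val, hval, hsame₃.realStack (k + 2) (by omega), hJ,
        Finset.sum_range_succ]
    · simp only [NatExpr.cost, RealExpr.cost]
      nlinarith
  · simp only [NatExpr.cost, RealExpr.cost]
    nlinarith

end Compilation

mutual
theorem NatTerm.computes_comp (G : Tables) (v : ℕ → ℕ) (k : ℕ) (e : NatTerm) :
    ComputesNat G v k (e.comp k) (e.time.eval G.bound) (e.eval G v) := by
  match e with
  | .lit n =>
    simp only [NatTerm.comp, NatTerm.eval, NatTerm.time, Polynomial.eval_ofNat]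
    exact ComputesNat.setNat fun s _ => rfl
  | .var x =>
    simp only [NatTerm.comp, NatTerm.eval, NatTerm.time, Polynomial.eval_ofNat]
    exact ComputesNat.setNat fun s hs => congrFun hs.var x
  | .read a e =>
    simp only [NatTerm.comp, NatTerm.eval, NatTerm.time, Polynomial.eval_add, Polynomial.eval_ofNat]
    exact (NatTerm.computes_comp G v k e).seq_setNat fun s hs he => by
      simp [NatExpr.val, he, hs.nat]
  | .add e f | .sub e f =>
    simp only [NatTerm.comp, NatTerm.eval, NatTerm.time, Polynomial.eval_add, Polynomial.eval_ofNat]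
    exact (NatTerm.computes_comp G v k e).seq_seq_setNat (NatTerm.computes_comp G v (k + 1) f)
      fun s he hf => by simp [NatExpr.val, he, hf]
  | .sum x r b =>
    simp only [NatTerm.comp, NatTerm.eval, NatTerm.time, Polynomial.eval_add, Polynomial.eval_mul,
      Polynomial.eval_X, Polynomial.eval_ofNat]
    exact ComputesNat.sum (NatTerm.computes_comp G v k r) fun i =>
      NatTerm.computes_comp G (Function.update v x i) _ b
  | .nonzero x =>
    simp only [NatTerm.comp, NatTerm.eval, NatTerm.time, Polynomial.eval_add, Polynomial.eval_ofNat]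
    exact (RealTerm.computes_comp G v k x).seq_ite
theorem RealTerm.computes_comp (G : Tables) (v : ℕ → ℕ) (k : ℕ) (x : RealTerm) :
    ComputesReal G v k (x.comp k) (x.time.eval G.bound) (x.eval G v) := by
  match x with
  | .read a e =>
    simp only [RealTerm.comp, RealTerm.eval, RealTerm.time, Polynomial.eval_add,
      Polynomial.eval_ofNat]
    exact (NatTerm.computes_comp G v k e).seq_setReal fun s hs he => by
      simp [NatExpr.val, RealExpr.val, he, hs.real]
  | .add x y | .sub x y | .mul x y =>
    simp only [RealTerm.comp, RealTerm.eval, RealTerm.time, Polynomial.eval_add,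
      Polynomial.eval_ofNat]
    exact (RealTerm.computes_comp G v k x).seq_seq_setReal (RealTerm.computes_comp G v (k + 1) y)
      fun s hx hy => by simp [RealExpr.val, NatExpr.val, hx, hy]
  | .sum x r b =>
    simp only [RealTerm.comp, RealTerm.eval, RealTerm.time, Polynomial.eval_add,
      Polynomial.eval_mul, Polynomial.eval_X, Polynomial.eval_ofNat]
    exact ComputesReal.sum (NatTerm.computes_comp G v k r) fun i =>
      RealTerm.computes_comp G (Function.update v x i) _ b
end

end RealRAM

namespace QMDP

open scoped MatrixOrder

/-! ### Positive semidefinite matrices -/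

section Matrix

variable {n : Type*} [Fintype n]

theorem trace_mul_nonneg {A B : Matrix n n ℂ} (hA : 0 ≤ A) (hB : 0 ≤ B) : 0 ≤ (A * B).trace := by
  classical
  obtain ⟨C, rfl⟩ := CStarAlgebra.nonneg_iff_eq_star_mul_self.1 hB
  rw [← mul_assoc, trace_mul_comm, ← mul_assoc]
  exact (nonneg_iff_posSemidef.1 (star_right_conjugate_nonneg hA C)).trace_nonneg

theorem trace_mul_le_trace_mul {A B C : Matrix n n ℂ} (hAB : A ≤ B) (hC : 0 ≤ C) :
    (A * C).trace ≤ (B * C).trace := by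
  have h := trace_mul_nonneg (sub_nonneg.2 hAB) hC
  rwa [sub_mul, trace_sub, sub_nonneg] at h

theorem mul_eq_zero_of_conjugate_eq_zero {A D : Matrix n n ℂ} (hA : 0 ≤ A)
    (h : star D * A * D = 0) : A * D = 0 := by
  classical
  obtain ⟨C, rfl⟩ := CStarAlgebra.nonneg_iff_eq_star_mul_self.1 hA
  have hCD : (C * D)ᴴ * (C * D) = 0 := by
    rw [conjTranspose_mul, ← h]
    simp only [star_eq_conjTranspose, mul_assoc]
  rw [mul_assoc, conjTranspose_mul_self_eq_zero.1 hCD, mul_zero]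

theorem exists_pos_smul_one_le {n : Type*} [Finite n] [DecidableEq n] {D : Matrix n n ℂ}
    (hD : D.PosDef) :
    ∃ ε : ℝ, 0 < ε ∧ ε • (1 : Matrix n n ℂ) ≤ D := by
  have := Fintype.ofFinite n
  cases isEmpty_or_nonempty n
  · exact ⟨1, one_pos, (Subsingleton.elim _ _).le⟩
  · obtain ⟨ε, hε, h⟩ := (CFC.exists_pos_algebraMap_le_iff hD.isHermitian.isSelfAdjoint).2 <| by
      rw [hD.isHermitian.spectrum_real_eq_range_eigenvalues]
      rintro _ ⟨i, rfl⟩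
      exact hD.eigenvalues_pos i
    exact ⟨ε, hε, by rwa [← Algebra.algebraMap_eq_smul_one]⟩

theorem posDef_of_nonneg_of_mulVec_eq_zero {D : Matrix n n ℂ} (hD : 0 ≤ D)
    (h : ∀ v, D *ᵥ v = 0 → v = 0) : D.PosDef := by
  rw [nonneg_iff_posSemidef] at hD
  refine .of_dotProduct_mulVec_pos hD.isHermitian fun v hv => ?_
  refine (hD.dotProduct_mulVec_nonneg v).lt_of_ne fun h0 => hv (h v ?_)
  exact (hD.dotProduct_mulVec_zero_iff v).1 h0.symm

theorem mul_eq_self_of_rankOne {A K C : Matrix n n ℂ} {φ η : n → ℂ} (hA : A = vecMulVec φ η)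
    (hne : A * C ≠ 0) (hfix : K * (A * C) = A * C) : K * A = A := by
  subst hA
  rw [vecMulVec_mul] at hfix hne
  rw [mul_vecMulVec] at hfix ⊢
  obtain ⟨j, hj⟩ : ∃ j, (η ᵥ* C) j ≠ 0 :=
    Function.ne_iff.1 fun h0 => hne (by rw [h0]; exact vecMulVec_zero _)
  congr 1
  ext i
  exact mul_right_cancel₀ hj (congrFun (congrFun hfix i) j)

theorem conjugate_eq_smul_of_rankOne {A : Matrix n n ℂ} {φ η : n → ℂ} (hA : A = vecMulVec φ η)
    (τ : Matrix n n ℂ) : ∃ c : ℂ, A * τ * Aᴴ = c • (A * Aᴴ) := by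
  subst hA
  obtain rfl | hη := eq_or_ne η 0
  · exact ⟨0, by simp⟩
  have h0 : η ⬝ᵥ star η ≠ 0 := by simpa [dotProduct_self_star_eq_zero] using hη
  refine ⟨(η ᵥ* τ ⬝ᵥ star η) / (η ⬝ᵥ star η), ?_⟩
  ext i j
  simp only [vecMulVec_mul, conjTranspose_vecMulVec, vecMul_vecMulVec, Matrix.smul_apply,
    vecMulVec_apply, smul_eq_mul, Pi.smul_apply]
  field_simp

theorem trace_re_smul_inv_trace_smul {σ : Matrix n n ℂ} (hσ : σ.PosSemidef) :
    (σ.trace.re : ℂ) • σ.trace⁻¹ • σ = σ := by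
  classical
  obtain h0 | h0 := eq_or_ne σ.trace 0
  · rw [hσ.trace_eq_zero_iff.1 h0, smul_zero, smul_zero]
  · rw [← Complex.eq_re_of_ofReal_le hσ.trace_nonneg, smul_smul, mul_inv_cancel₀ h0, one_smul]

end Matrix

theorem isDensity_inv_trace_smul {d : ℕ} {σ : Matrix (Fin d) (Fin d) ℂ} (hσ : σ.PosSemidef)
    (h0 : σ ≠ 0) : IsDensity (σ.trace⁻¹ • σ) := by
  refine ⟨hσ.smul (inv_nonneg.2 hσ.trace_nonneg), ?_⟩
  rw [trace_smul, smul_eq_mul, inv_mul_cancel₀ fun h => h0 (hσ.trace_eq_zero_iff.1 h)]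

/-! ### The projection onto a subspace -/

section Projection

variable {d : ℕ} (B : Submodule ℂ (EuclideanSpace ℂ (Fin d)))

theorem isStarProjection_projMatrix : IsStarProjection (projMatrix B) :=
  (isStarProjection_starProjection (U := B)).map
    (toEuclideanCLM (n := Fin d) (𝕜 := ℂ)).symm

theorem toEuclideanLin_projMatrix_mul (ρ : Matrix (Fin d) (Fin d) ℂ)
    (v : EuclideanSpace ℂ (Fin d)) :
    toEuclideanLin (projMatrix B * ρ) v = B.starProjection (toEuclideanLin ρ v) := by
  have h : toEuclideanLin (projMatrix B * ρ) v =
      toEuclideanLin (projMatrix B) (toEuclideanLin ρ v) := by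
    simp [toLpLin_apply]
  rw [h, projMatrix, LinearEquiv.apply_symm_apply, ContinuousLinearMap.coe_coe]

theorem supp_le_iff (ρ : Matrix (Fin d) (Fin d) ℂ) : supp ρ ≤ B ↔ projMatrix B * ρ = ρ := by
  rw [← toEuclideanLin.injective.eq_iff, LinearMap.ext_iff, supp]
  simp only [toEuclideanLin_projMatrix_mul, Submodule.starProjection_eq_self_iff]
  exact Set.range_subset_iff

end Projection

/-! ### Weighted states and the dual evolution -/

/-- The event observed when the operator `k` of the choice `x` acts: an action leaves no record of
which of its Kraus operators acted. -/
def ev (M : QMDP) : (x : M.Choice) → Fin (M.fam x).len → M.Event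
  | Sum.inl α, _ => Sum.inl α
  | Sum.inr β, k => Sum.inr ⟨β, k⟩

@[simp] theorem choiceOf_ev (M : QMDP) (x : M.Choice) (k : Fin (M.fam x).len) :
    M.choiceOf (M.ev x k) = x := by
  cases x <;> rfl

/-- The operators of an action or of a measurement. -/
def kraus (M : QMDP) (x : M.Choice) (k : Fin (M.fam x).len) : Matrix (Fin M.dim) (Fin M.dim) ℂ :=
  (M.fam x).op k

theorem sum_kraus (M : QMDP) (x : M.Choice) : ∑ k, star (M.kraus x k) * M.kraus x k = 1 :=
  (M.fam x).complete

/-- All operators of the qMDP have rank at most one. -/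
def RankOneKraus (M : QMDP) : Prop :=
  ∀ x k, ∃ φ η : Fin M.dim → ℂ, M.kraus x k = vecMulVec φ η

/-- The state `p_w ρ_w`. -/
noncomputable def weightedState (M : QMDP) (S : M.Scheduler)
    (ρ : Matrix (Fin M.dim) (Fin M.dim) ℂ) (w : List M.Event) : Matrix (Fin M.dim) (Fin M.dim) ℂ :=
  ((M.config S ρ w).2 : ℂ) • (M.config S ρ w).1

section Evolution

variable {M : QMDP} {S : M.Scheduler} {ρ Z : Matrix (Fin M.dim) (Fin M.dim) ℂ}

theorem config_nonneg (hρ : ρ.PosSemidef) (w : List M.Event) :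
    (M.config S ρ w).1.PosSemidef ∧ 0 ≤ (M.config S ρ w).2 := by
  induction w with
  | nil => exact ⟨hρ, zero_le_one⟩
  | cons e w ih =>
    rcases e with α | ⟨β, j⟩ <;> rw [config] <;> split_ifs
    · exact ⟨posSemidef_sum _ fun i _ => ih.1.mul_mul_conjTranspose_same _, ih.2⟩
    · exact ⟨.zero, le_rfl⟩
    · have hσ := ih.1.mul_mul_conjTranspose_same ((M.meas β).op j)
      exact ⟨hσ.smul (inv_nonneg.2 hσ.trace_nonneg),
        mul_nonneg ih.2 (Complex.nonneg_iff.1 hσ.trace_nonneg).1⟩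
    · exact ⟨.zero, le_rfl⟩

theorem weightedState_nonneg (hρ : ρ.PosSemidef) (w : List M.Event) :
    0 ≤ M.weightedState S ρ w :=
  ((config_nonneg hρ w).1.smul (Complex.zero_le_real.2 (config_nonneg hρ w).2)).nonneg

theorem weightedState_nil : M.weightedState S ρ [] = ρ := by
  simp [weightedState, config]

theorem weightedState_cons (hρ : ρ.PosSemidef) (e : M.Event) (w : List M.Event) :
    M.weightedState S ρ (e :: w) = ∑ k, if M.ev (S w) k = e then
      M.kraus (S w) k * M.weightedState S ρ w * star (M.kraus (S w) k) else 0 := by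
  generalize hx : S w = x
  by_cases he : M.choiceOf e = x
  · rcases e with α | ⟨β, j⟩ <;> subst he
    · simp only [weightedState, config, hx, choiceOf, if_true, OpFamily.superOp, Finset.smul_sum,
        mul_smul_comm, smul_mul_assoc]
      exact Finset.sum_congr rfl fun k _ => (if_pos rfl).symm
    · simp only [weightedState, config, hx, choiceOf, if_true, mul_smul_comm, smul_mul_assoc]
      rw [Complex.ofReal_mul, mul_smul, trace_re_smul_inv_trace_smul
        ((config_nonneg hρ w).1.mul_mul_conjTranspose_same _)]
      symm
      refine (Fintype.sum_eq_single j fun k hk => if_neg fun h => hk ?_).trans (if_pos rfl)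
      exact sigma_mk_injective (i := β) (Sum.inr.inj h)
  · rw [Finset.sum_eq_zero fun k _ => if_neg fun h => he (by rw [← h, choiceOf_ev])]
    rcases e with α | ⟨β, j⟩ <;>
    · have hne := Ne.symm he
      simp only [choiceOf] at hne
      simp only [weightedState, config, hx, if_neg hne, smul_zero]

theorem weightedState_eq_zero (hρ : ρ.PosSemidef) {w : List M.Event} (hw : ¬ M.Consistent S w) :
    M.weightedState S ρ w = 0 := by
  induction w with
  | nil => exact (hw trivial).elim
  | cons e w ih =>
    rw [weightedState_cons hρ]
    refine Finset.sum_eq_zero fun k _ => ite_eq_right_iff.2 fun hk => ?_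
    rw [ih fun hw' => hw ⟨by rw [← hk, choiceOf_ev], hw'⟩, mul_zero, zero_mul]

/-- The dual evolution: the observable `Z`, measured after `n` more steps, as an observable of the
state after the history `w`. -/
noncomputable def dual (M : QMDP) (S : M.Scheduler) (Z : Matrix (Fin M.dim) (Fin M.dim) ℂ) :
    ℕ → List M.Event → Matrix (Fin M.dim) (Fin M.dim) ℂ
  | 0, _ => Z
  | n + 1, w => ∑ k, star (M.kraus (S w) k) * M.dual S Z n (M.ev (S w) k :: w) * M.kraus (S w) k

/-- The expectation of the observable `Z` after `m + n` steps, the last `n` of them being taken in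
the dual picture. -/
noncomputable def expect (M : QMDP) (S : M.Scheduler) (ρ Z : Matrix (Fin M.dim) (Fin M.dim) ℂ)
    (m n : ℕ) : ℂ :=
  ∑ w : Fin m → M.Event, (M.dual S Z n (List.ofFn w) * M.weightedState S ρ (List.ofFn w)).trace

theorem trace_dual_succ_mul (hρ : ρ.PosSemidef) (n : ℕ) (w : List M.Event) :
    (M.dual S Z (n + 1) w * M.weightedState S ρ w).trace =
      ∑ e, (M.dual S Z n (e :: w) * M.weightedState S ρ (e :: w)).trace := by
  classical
  simp only [weightedState_cons hρ, dual, Finset.mul_sum, Finset.sum_mul, trace_sum, mul_ite,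
    mul_zero]
  rw [Finset.sum_comm]
  refine Finset.sum_congr rfl fun k _ => ?_
  simp only [apply_ite trace, trace_zero, Fintype.sum_ite_eq]
  rw [mul_assoc, mul_assoc, trace_mul_comm]
  simp only [mul_assoc]

theorem expect_succ (hρ : ρ.PosSemidef) (m n : ℕ) :
    M.expect S ρ Z (m + 1) n = M.expect S ρ Z m (n + 1) := by
  rw [expect, ← (Fin.consEquiv fun _ => M.Event).sum_comp, Fintype.sum_prod_type_right, expect]
  refine Finset.sum_congr rfl fun w _ => ?_
  rw [trace_dual_succ_mul hρ]
  refine Finset.sum_congr rfl fun e _ => ?_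
  rw [show List.ofFn ((Fin.consEquiv fun _ => M.Event) (e, w)) = e :: List.ofFn w from
    List.ofFn_cons e w]

theorem expect_add (hρ : ρ.PosSemidef) (m n : ℕ) :
    M.expect S ρ Z (m + n) 0 = M.expect S ρ Z m n := by
  suffices ∀ j, M.expect S ρ Z (m + n) j = M.expect S ρ Z m (n + j) from this 0
  induction n with
  | zero => simp
  | succ n ih => intro j; rw [← add_assoc, expect_succ hρ, ih, add_right_comm n 1 j, add_assoc]

theorem dual_one (n : ℕ) (w : List M.Event) : M.dual S 1 n w = 1 := by
  induction n generalizing w with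
  | zero => rfl
  | succ n ih => simp only [dual, ih, mul_one, sum_kraus]

theorem expect_one (hρ : IsDensity ρ) (m : ℕ) : M.expect S ρ 1 m 0 = 1 := by
  rw [← zero_add m, expect_add hρ.1, expect, Fintype.sum_unique, List.ofFn_zero, dual_one, one_mul,
    weightedState_nil, hρ.2]

theorem expect_one_sub (hρ : IsDensity ρ) (m : ℕ) :
    M.expect S ρ (1 - Z) m 0 = 1 - M.expect S ρ Z m 0 := by
  rw [← expect_one (S := S) hρ m]
  simp only [expect, dual, sub_mul, trace_sub, Finset.sum_sub_distrib]

theorem probAt_eq (S : M.Scheduler) (hρ : IsDensity ρ)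
    (B : Submodule ℂ (EuclideanSpace ℂ (Fin M.dim))) (n : ℕ) :
    M.probAt S ρ B n = 1 - (M.expect S ρ (1 - projMatrix B) n 0).re := by
  rw [expect_one_sub hρ, Complex.sub_re, Complex.one_re, sub_sub_cancel]
  simp only [probAt, globalState, Finset.mul_sum, trace_sum, expect, dual, weightedState]

end Evolution

end QMDP

namespace QMDP

open scoped MatrixOrder

/-! ### The projection onto the complement of an invariant subspace -/

section Projection

variable {n : Type*} [Fintype n] [DecidableEq n] {P Q K : Matrix n n ℂ}

theorem one_sub_mul_mul_eq_zero {ι : Type*} [Fintype ι] (hP : IsStarProjection P)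
    {A : ι → Matrix n n ℂ}
    (h : P * ∑ i, A i * P * star (A i) = ∑ i, A i * P * star (A i)) (i : ι) :
    (1 - P) * A i * P = 0 := by
  have hsum : ∑ i, (1 - P) * A i * P * star ((1 - P) * A i * P) = 0 := by
    have hterm (i : ι) : (1 - P) * A i * P * star ((1 - P) * A i * P) =
        (1 - P) * (A i * P * star (A i)) * (1 - P) := by
      rw [star_mul, star_mul, hP.isSelfAdjoint.star_eq, hP.one_sub.isSelfAdjoint.star_eq]
      simp only [mul_assoc]
      rw [← mul_assoc P P, hP.isIdempotentElem.eq]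
    simp only [hterm]
    rw [← Finset.sum_mul, ← Finset.mul_sum, sub_mul, one_mul, h, sub_self, zero_mul]
  rw [Finset.sum_eq_zero_iff_of_nonneg fun i _ => mul_star_self_nonneg _] at hsum
  exact self_mul_conjTranspose_eq_zero.1 (hsum i (Finset.mem_univ i))

open scoped Matrix.Norms.L2Operator in
theorem le_smul_of_smul_one_le_one_sub (hQ : IsStarProjection Q) (hK : K ∈ Set.Icc 0 Q) {ε : ℝ}
    (h : ε • (1 : Matrix n n ℂ) ≤ 1 - K) : K ≤ (1 - ε) • Q := by
  have hK1 : K ≤ (1 - ε) • (1 : Matrix n n ℂ) := by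
    rw [sub_smul, one_smul]
    exact le_sub_comm.1 h
  have hconj := star_left_conjugate_le_conjugate hK1 Q
  rwa [hQ.isSelfAdjoint.star_eq, hQ.conjugate_of_nonneg_of_le hK.1 hK.2, mul_smul_comm,
    smul_mul_assoc, mul_one, hQ.isIdempotentElem.eq] at hconj

end Projection

theorem one_sub_projMatrix_mul_mul_projMatrix {d : ℕ} {ι : Type*} [Fintype ι]
    {B : Submodule ℂ (EuclideanSpace ℂ (Fin d))} {A : ι → Matrix (Fin d) (Fin d) ℂ}
    (h : ∀ ρ, IsDensity ρ → supp ρ ≤ B → supp (∑ i, A i * ρ * (A i)ᴴ) ≤ B) (i : ι) :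
    (1 - projMatrix B) * A i * projMatrix B = 0 := by
  have hP := isStarProjection_projMatrix B
  obtain h0 | h0 := eq_or_ne (projMatrix B) 0
  · rw [h0, mul_zero]
  have hpos := nonneg_iff_posSemidef.1 hP.nonneg
  have ht : (projMatrix B).trace⁻¹ ≠ 0 := inv_ne_zero fun ht => h0 (hpos.trace_eq_zero_iff.1 ht)
  have hρ := h _ (isDensity_inv_trace_smul hpos h0)
    ((supp_le_iff _ _).2 (by rw [mul_smul_comm, hP.isIdempotentElem.eq]))
  simp only [supp_le_iff, mul_smul_comm, smul_mul_assoc, ← Finset.smul_sum] at hρ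
  exact one_sub_mul_mul_eq_zero hP (smul_right_injective _ ht hρ) i

section Invariant

variable {M : QMDP} {B : Submodule ℂ (EuclideanSpace ℂ (Fin M.dim))}

theorem Invariant.one_sub_projMatrix_mul_kraus (hB : M.Invariant B) (x : M.Choice)
    (k : Fin (M.fam x).len) :
    (1 - projMatrix B) * M.kraus x k = (1 - projMatrix B) * M.kraus x k * (1 - projMatrix B) := by
  have h : (1 - projMatrix B) * M.kraus x k * projMatrix B = 0 := by
    rcases x with α | β
    · exact one_sub_projMatrix_mul_mul_projMatrix (hB.1 α) k
    · exact one_sub_projMatrix_mul_mul_projMatrix (ι := Unit) (A := fun _ => (M.meas β).op k)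
        (by simpa using hB.2 β k) ()
  rw [mul_sub, mul_one, h, sub_zero]

theorem Invariant.sum_conjugate_le (hB : M.Invariant B) (x : M.Choice) :
    ∑ k, star (M.kraus x k) * (1 - projMatrix B) * M.kraus x k ≤ 1 - projMatrix B := by
  have hQ := (isStarProjection_projMatrix B).one_sub
  have hterm (k : Fin (M.fam x).len) :
      star (M.kraus x k) * (1 - projMatrix B) * M.kraus x k ≤
        star (1 - projMatrix B) * (star (M.kraus x k) * M.kraus x k) * (1 - projMatrix B) :=
    calc
      _ = star ((1 - projMatrix B) * M.kraus x k) * ((1 - projMatrix B) * M.kraus x k) := by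
        rw [star_mul, hQ.isSelfAdjoint.star_eq, mul_assoc, mul_assoc, ← mul_assoc (1 - _) (1 - _),
          hQ.isIdempotentElem.eq]
      _ = star (M.kraus x k * (1 - projMatrix B)) * (1 - projMatrix B) *
          (M.kraus x k * (1 - projMatrix B)) := by
        rw [hB.one_sub_projMatrix_mul_kraus, mul_assoc (1 - projMatrix B), star_mul,
          hQ.isSelfAdjoint.star_eq, mul_assoc, mul_assoc, ← mul_assoc (1 - projMatrix B)
          (1 - projMatrix B), hQ.isIdempotentElem.eq]
      _ ≤ star (M.kraus x k * (1 - projMatrix B)) * 1 * (M.kraus x k * (1 - projMatrix B)) :=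
        star_left_conjugate_le_conjugate hQ.le_one _
      _ = _ := by rw [mul_one, star_mul]; simp only [mul_assoc]
  refine (Finset.sum_le_sum fun k _ => hterm k).trans_eq ?_
  rw [← Finset.sum_mul, ← Finset.mul_sum, sum_kraus, mul_one, hQ.isSelfAdjoint.star_eq,
    hQ.isIdempotentElem.eq]

end Invariant

/-! ### Avoiding the subspace forever -/

/-- What an observer knows after a step of a history: the last choice, and a set of operators of
this choice one of which acted. -/
abbrev Node (M : QMDP) : Type := Σ x : M.Choice, Set (Fin (M.fam x).len)

/-- The node after the event `e` at the node `ν`: it keeps the operators that are compatible with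
`e` and with some operator of `ν`. -/
def step (M : QMDP) (ν : M.Node) (e : M.Event) : M.Node :=
  ⟨M.choiceOf e, {k | (∃ i ∈ ν.2, M.kraus (M.choiceOf e) k * M.kraus ν.1 i ≠ 0) ∧
    M.ev (M.choiceOf e) k = e}⟩

/-- The node after a history that starts at the node `ν`. -/
def nodeAfter (M : QMDP) (ν : M.Node) : List M.Event → M.Node
  | [] => ν
  | e :: w => M.step (M.nodeAfter ν w) e

/-- From the node `ν`, available choices can be made `n` times such that, whatever the events, all
states but the last are orthogonal to `B`. -/
def CanAvoid (M : QMDP) (B : Submodule ℂ (EuclideanSpace ℂ (Fin M.dim))) : ℕ → M.Node → Prop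
  | 0, _ => True
  | n + 1, ν => (∀ i ∈ ν.2, projMatrix B * M.kraus ν.1 i = 0) ∧
      ∃ y ∈ M.avail ν.1, ∀ k, M.CanAvoid B n (M.step ν (M.ev y k))

theorem step_ev (M : QMDP) (ν : M.Node) (y : M.Choice) (k : Fin (M.fam y).len) :
    M.step ν (M.ev y k) = ⟨y, {k' | (∃ i ∈ ν.2, M.kraus y k' * M.kraus ν.1 i ≠ 0) ∧
      M.ev y k' = M.ev y k}⟩ := by
  cases y <;> rfl

theorem len_pos (M : QMDP) [NeZero M.dim] (x : M.Choice) : 0 < (M.fam x).len := by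
  by_contra h
  have : IsEmpty (Fin (M.fam x).len) := by rw [Nat.eq_zero_of_not_pos h]; infer_instance
  have h1 := M.sum_kraus x
  rw [Finset.univ_eq_empty, Finset.sum_empty] at h1
  exact zero_ne_one h1

theorem exists_ev_eq (M : QMDP) [NeZero M.dim] (e : M.Event) :
    ∃ k, M.ev (M.choiceOf e) k = e := by
  rcases e with α | ⟨β, j⟩
  · exact ⟨⟨0, M.len_pos (Sum.inl α)⟩, rfl⟩
  · exact ⟨j, rfl⟩

section Avoiding

variable {M : QMDP} {B : Submodule ℂ (EuclideanSpace ℂ (Fin M.dim))} {ν : M.Node}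

theorem CanAvoid.of_succ {n : ℕ} (h : M.CanAvoid B (n + 1) ν) : M.CanAvoid B n ν := by
  induction n generalizing ν with
  | zero => trivial
  | succ n ih =>
    obtain ⟨hB, y, hy, hnext⟩ := h
    exact ⟨hB, y, hy, fun k => ih (hnext k)⟩

theorem antitone_canAvoid (B : Submodule ℂ (EuclideanSpace ℂ (Fin M.dim))) (ν : M.Node) :
    Antitone fun n => M.CanAvoid B n ν :=
  antitone_nat_of_succ_le fun _ => CanAvoid.of_succ

theorem exists_avail_forall_canAvoid (h : ∀ n, M.CanAvoid B n ν) :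
    ∃ y ∈ M.avail ν.1, ∀ k n, M.CanAvoid B n (M.step ν (M.ev y k)) := by
  by_contra! hc
  choose! k n hkn using hc
  obtain ⟨-, y, hy, hnext⟩ := h ((M.avail ν.1).sup n + 1)
  exact hkn y hy (antitone_canAvoid B _ (Finset.le_sup hy) (hnext (k y hy)))

open Classical in
/-- A choice after which `B` can still be avoided forever, if there is one. -/
noncomputable def avoidingChoice (M : QMDP) (B : Submodule ℂ (EuclideanSpace ℂ (Fin M.dim)))
    (ν : M.Node) : M.Choice :=
  if h : ∀ n, M.CanAvoid B n ν then (exists_avail_forall_canAvoid h).choose else ν.1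

/-- The scheduler that makes avoiding choices along the nodes of the history. -/
noncomputable def avoidingScheduler (M : QMDP) (B : Submodule ℂ (EuclideanSpace ℂ (Fin M.dim)))
    (ν : M.Node) : M.Scheduler :=
  fun w => M.avoidingChoice B (M.nodeAfter ν w)

theorem avoidingChoice_spec (h : ∀ n, M.CanAvoid B n ν) :
    M.avoidingChoice B ν ∈ M.avail ν.1 ∧
      ∀ k n, M.CanAvoid B n (M.step ν (M.ev (M.avoidingChoice B ν) k)) := by
  rw [avoidingChoice, dif_pos h]
  exact (exists_avail_forall_canAvoid h).choose_spec

theorem canAvoid_nodeAfter [NeZero M.dim] (h : ∀ n, M.CanAvoid B n ν) {w : List M.Event}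
    (hw : M.Consistent (M.avoidingScheduler B ν) w) (n : ℕ) :
    M.CanAvoid B n (M.nodeAfter ν w) := by
  induction w generalizing n with
  | nil => exact h n
  | cons e w ih =>
    obtain ⟨hS, hw⟩ := hw
    have hnext := (avoidingChoice_spec (ih hw)).2
    rw [show M.avoidingChoice B (M.nodeAfter ν w) = M.choiceOf e from hS] at hnext
    obtain ⟨k, hk⟩ := M.exists_ev_eq e
    simpa only [nodeAfter, hk] using hnext k n

theorem admissible_avoidingScheduler [NeZero M.dim] (h : ∀ n, M.CanAvoid B n ν) :
    M.Admissible (M.avoidingScheduler B ν) :=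
  fun _ _ hw => (avoidingChoice_spec (canAvoid_nodeAfter h hw)).1

/-- The span of the states `A A†` for the operators `A` of a node. -/
def Node.span (ν : M.Node) : Submodule ℂ (Matrix (Fin M.dim) (Fin M.dim) ℂ) :=
  Submodule.span ℂ ((fun i => M.kraus ν.1 i * star (M.kraus ν.1 i)) '' ν.2)

theorem Node.mul_eq_zero_of_mem_span {A σ : Matrix (Fin M.dim) (Fin M.dim) ℂ}
    (hA : ∀ i ∈ ν.2, A * M.kraus ν.1 i = 0) (hσ : σ ∈ ν.span) : A * σ = 0 := by
  suffices ν.span ≤ LinearMap.ker (LinearMap.mulLeft ℂ A) from this hσ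
  refine Submodule.span_le.2 ?_
  rintro _ ⟨i, hi, rfl⟩
  simp only [SetLike.mem_coe, LinearMap.mem_ker, LinearMap.mulLeft_apply]
  rw [← mul_assoc, hA i hi, zero_mul]

theorem conjugate_mem_span_step (hR : M.RankOneKraus) {σ : Matrix (Fin M.dim) (Fin M.dim) ℂ}
    (hσ : σ ∈ ν.span) {e : M.Event} {k : Fin (M.fam (M.choiceOf e)).len}
    (hk : M.ev (M.choiceOf e) k = e) :
    M.kraus (M.choiceOf e) k * σ * star (M.kraus (M.choiceOf e) k) ∈ (M.step ν e).span := by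
  by_cases hne : ∃ i ∈ ν.2, M.kraus (M.choiceOf e) k * M.kraus ν.1 i ≠ 0
  · obtain ⟨φ, η, hA⟩ := hR (M.choiceOf e) k
    obtain ⟨c, hc⟩ := conjugate_eq_smul_of_rankOne hA σ
    rw [star_eq_conjTranspose, hc]
    exact Submodule.smul_mem _ _ (Submodule.subset_span ⟨k, ⟨hne, hk⟩, rfl⟩)
  · push Not at hne
    rw [Node.mul_eq_zero_of_mem_span hne hσ, zero_mul]
    exact Submodule.zero_mem _

theorem weightedState_mem_span (hR : M.RankOneKraus) {S : M.Scheduler}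
    {ρ : Matrix (Fin M.dim) (Fin M.dim) ℂ} (hρ : ρ.PosSemidef) (hν : ρ ∈ ν.span)
    (w : List M.Event) : M.weightedState S ρ w ∈ (M.nodeAfter ν w).span := by
  induction w with
  | nil => rwa [weightedState_nil]
  | cons e w ih =>
    rw [weightedState_cons hρ]
    refine Submodule.sum_mem _ fun k _ => ?_
    split_ifs with hk
    · obtain hS : S w = M.choiceOf e := by rw [← hk, choiceOf_ev]
      generalize S w = x at k hk hS
      subst hS
      exact conjugate_mem_span_step hR ih hk
    · exact Submodule.zero_mem _

theorem not_alwaysReaches_of_canAvoid (hR : M.RankOneKraus) {x : M.Choice}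
    {i : Fin (M.fam x).len} (hne : M.kraus x i ≠ 0) (h : ∀ n, M.CanAvoid B n ⟨x, {i}⟩) :
    ¬ M.AlwaysReaches B := by
  have : NeZero M.dim := ⟨fun h0 => hne (by
    have : IsEmpty (Fin M.dim) := by rw [h0]; infer_instance
    exact Subsingleton.elim _ _)⟩
  have hρ := isDensity_inv_trace_smul (posSemidef_self_mul_conjTranspose (M.kraus x i))
    (self_mul_conjTranspose_eq_zero.not.2 hne)
  set S := M.avoidingScheduler B ⟨x, {i}⟩
  set ρ := (M.kraus x i * (M.kraus x i)ᴴ).trace⁻¹ • (M.kraus x i * (M.kraus x i)ᴴ)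
  have hspan : ρ ∈ Node.span (M := M) ⟨x, {i}⟩ :=
    Submodule.smul_mem _ _ (Submodule.subset_span ⟨i, rfl, rfl⟩)
  have horth (w : List M.Event) : projMatrix B * M.weightedState S ρ w = 0 := by
    by_cases hw : M.Consistent S w
    · exact Node.mul_eq_zero_of_mem_span (canAvoid_nodeAfter h hw 1).1
        (weightedState_mem_span hR hρ.1 hspan w)
    · rw [weightedState_eq_zero hρ.1 hw, mul_zero]
  have hprob : M.probAt S ρ B = fun _ => 0 := by
    funext n
    simp only [weightedState] at horth
    simp only [probAt, globalState, Finset.mul_sum, horth, Finset.sum_const_zero, trace_zero,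
      Complex.zero_re]
  intro hall
  have hlim := hall S (admissible_avoidingScheduler h) ρ hρ
  rw [HasReachProb, hprob] at hlim
  exact zero_ne_one (tendsto_nhds_unique tendsto_const_nhds hlim)

end Avoiding

/-! ### Almost sure reachability -/

/-- The observables before the choice `y`, given the set of possible observables after it. -/
def dualStep (M : QMDP) (y : M.Choice) (𝒦 : Set (Matrix (Fin M.dim) (Fin M.dim) ℂ)) :
    Set (Matrix (Fin M.dim) (Fin M.dim) ℂ) :=
  {K | ∃ f : M.Event → Matrix (Fin M.dim) (Fin M.dim) ℂ, (∀ k, f (M.ev y k) ∈ 𝒦) ∧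
    K = ∑ k, star (M.kraus y k) * f (M.ev y k) * M.kraus y k}

/-- The observables into which the dual evolutions along admissible schedulers can turn `1 - P_B` in
`n` steps, after the choice `x`. -/
def dualSet (M : QMDP) (B : Submodule ℂ (EuclideanSpace ℂ (Fin M.dim))) :
    ℕ → M.Choice → Set (Matrix (Fin M.dim) (Fin M.dim) ℂ)
  | 0, _ => {1 - projMatrix B}
  | n + 1, x => ⋃ y ∈ M.avail x, M.dualStep y (M.dualSet B n y)

theorem finite_dualStep (M : QMDP) (y : M.Choice) {𝒦 : Set (Matrix (Fin M.dim) (Fin M.dim) ℂ)}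
    (h : 𝒦.Finite) : (M.dualStep y 𝒦).Finite := by
  have hf : (Set.univ.pi fun _ : Fin (M.fam y).len => 𝒦).Finite := Set.Finite.pi fun _ => h
  refine (hf.image fun g => ∑ k, star (M.kraus y k) * g k * M.kraus y k).subset ?_
  rintro K ⟨f, hfk, rfl⟩
  exact ⟨fun k => f (M.ev y k), fun k _ => hfk k, rfl⟩

theorem finite_dualSet (M : QMDP) (B : Submodule ℂ (EuclideanSpace ℂ (Fin M.dim))) (n : ℕ)
    (x : M.Choice) : (M.dualSet B n x).Finite := by
  induction n generalizing x with
  | zero => exact Set.finite_singleton _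
  | succ n ih => exact (Finset.finite_toSet _).biUnion fun y _ => M.finite_dualStep y (ih y)

section Dual

variable {M : QMDP} {B : Submodule ℂ (EuclideanSpace ℂ (Fin M.dim))}

theorem dual_mem_dualSet {S : M.Scheduler} (hS : M.Admissible S) (n : ℕ) {e : M.Event}
    {w : List M.Event} (hw : M.Consistent S (e :: w)) :
    M.dual S (1 - projMatrix B) n (e :: w) ∈ M.dualSet B n (M.choiceOf e) := by
  induction n generalizing e w with
  | zero => rfl
  | succ n ih =>
    refine Set.mem_biUnion (hS e w hw)
      ⟨fun e' => M.dual S (1 - projMatrix B) n (e' :: e :: w), fun k => ?_, rfl⟩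
    simpa only [choiceOf_ev] using
      ih (e := M.ev (S (e :: w)) k) (w := e :: w) ⟨by rw [choiceOf_ev], hw⟩

theorem dual_mem_dualStep {S : M.Scheduler} (hS : M.Admissible S) (n : ℕ) {w : List M.Event}
    (hw : M.Consistent S w) :
    M.dual S (1 - projMatrix B) (n + 1) w ∈ M.dualStep (S w) (M.dualSet B n (S w)) := by
  refine ⟨fun e' => M.dual S (1 - projMatrix B) n (e' :: w), fun k => ?_, rfl⟩
  simpa only [choiceOf_ev] using
    dual_mem_dualSet hS n (e := M.ev (S w) k) (w := w) ⟨by rw [choiceOf_ev], hw⟩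

theorem dualStep_subset_Icc (hB : M.Invariant B) {y : M.Choice}
    {𝒦 : Set (Matrix (Fin M.dim) (Fin M.dim) ℂ)} (h : 𝒦 ⊆ Set.Icc 0 (1 - projMatrix B)) :
    M.dualStep y 𝒦 ⊆ Set.Icc 0 (1 - projMatrix B) := by
  rintro K ⟨f, hf, rfl⟩
  exact ⟨Finset.sum_nonneg fun k _ => star_left_conjugate_nonneg (h (hf k)).1 _,
    (Finset.sum_le_sum fun k _ => star_left_conjugate_le_conjugate (h (hf k)).2 _).trans
      (hB.sum_conjugate_le y)⟩

theorem dualSet_subset_Icc (hB : M.Invariant B) (n : ℕ) (x : M.Choice) :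
    M.dualSet B n x ⊆ Set.Icc 0 (1 - projMatrix B) := by
  induction n generalizing x with
  | zero =>
    rintro _ rfl
    exact ⟨(isStarProjection_projMatrix B).one_sub_nonneg, le_rfl⟩
  | succ n ih => exact Set.iUnion₂_subset fun y _ => dualStep_subset_Icc hB (ih y)

theorem mul_kraus_mul_eq_of_sum_mul_eq (y : M.Choice)
    {f : Fin (M.fam y).len → Matrix (Fin M.dim) (Fin M.dim) ℂ} (hf : ∀ k, f k ≤ 1)
    {C : Matrix (Fin M.dim) (Fin M.dim) ℂ}
    (hC : (∑ k, star (M.kraus y k) * f k * M.kraus y k) * C = C) (k : Fin (M.fam y).len) :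
    f k * (M.kraus y k * C) = M.kraus y k * C := by
  have hsum : ∑ k, star (M.kraus y k * C) * (1 - f k) * (M.kraus y k * C) = 0 :=
    calc
      _ = star C * ((∑ k, star (M.kraus y k) * M.kraus y k -
          ∑ k, star (M.kraus y k) * f k * M.kraus y k) * C) := by
        rw [← Finset.sum_sub_distrib, Finset.sum_mul, Finset.mul_sum]
        simp only [star_mul, mul_sub, sub_mul, mul_one, mul_assoc]
      _ = 0 := by rw [sum_kraus, sub_mul, hC, one_mul, sub_self, mul_zero]
  rw [Finset.sum_eq_zero_iff_of_nonneg fun k _ =>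
    star_left_conjugate_nonneg (sub_nonneg.2 (hf k)) _] at hsum
  have hzero := mul_eq_zero_of_conjugate_eq_zero (sub_nonneg.2 (hf k)) (hsum k (Finset.mem_univ k))
  rw [sub_mul, one_mul, sub_eq_zero] at hzero
  exact hzero.symm

open scoped Matrix.Norms.L2Operator in
theorem projMatrix_mul_eq_zero {d : ℕ} {B : Submodule ℂ (EuclideanSpace ℂ (Fin d))}
    {K C : Matrix (Fin d) (Fin d) ℂ} (hK : K ∈ Set.Icc 0 (1 - projMatrix B)) (hC : K * C = C) :
    projMatrix B * C = 0 := by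
  have hP := isStarProjection_projMatrix B
  have hQK := (hP.one_sub.mul_right_and_mul_left_of_nonneg_of_le hK.1 hK.2).2
  rw [← hC, ← hQK, ← mul_assoc, ← mul_assoc, hP.mul_one_sub_self, zero_mul, zero_mul]

theorem canAvoid_of_mul_kraus_eq (hB : M.Invariant B) (hR : M.RankOneKraus) {n : ℕ}
    {ν : M.Node} {K : Matrix (Fin M.dim) (Fin M.dim) ℂ} (hK : K ∈ M.dualSet B n ν.1)
    (hν : ∀ i ∈ ν.2, K * M.kraus ν.1 i = M.kraus ν.1 i) : M.CanAvoid B n ν := by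
  induction n generalizing ν K with
  | zero => trivial
  | succ n ih =>
    refine ⟨fun i hi => projMatrix_mul_eq_zero (dualSet_subset_Icc hB _ _ hK) (hν i hi), ?_⟩
    obtain ⟨y, hy, f, hf, rfl⟩ := Set.mem_iUnion₂.1 hK
    refine ⟨y, hy, fun k => ?_⟩
    rw [step_ev]
    refine ih (hf k) ?_
    rintro k' ⟨⟨i, hi, hne⟩, hev⟩
    obtain ⟨φ, η, hA⟩ := hR y k'
    have hle (k) : f (M.ev y k) ≤ 1 := (dualSet_subset_Icc hB _ _ (hf k)).2.trans
      (isStarProjection_projMatrix B).one_sub.le_one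
    rw [← hev]
    exact mul_eq_self_of_rankOne hA hne (mul_kraus_mul_eq_of_sum_mul_eq y hle (hν i hi) k')

theorem posDef_one_sub_of_mem_dualStep (hB : M.Invariant B) (hR : M.RankOneKraus) {n : ℕ}
    (hn : ∀ x i, M.kraus x i ≠ 0 → ¬ M.CanAvoid B n ⟨x, {i}⟩) {y : M.Choice}
    {K : Matrix (Fin M.dim) (Fin M.dim) ℂ} (hK : K ∈ M.dualStep y (M.dualSet B n y)) :
    (1 - K).PosDef := by
  have hle {L} (hL : L ∈ Set.Icc 0 (1 - projMatrix B)) : L ≤ 1 :=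
    hL.2.trans (isStarProjection_projMatrix B).one_sub.le_one
  refine posDef_of_nonneg_of_mulVec_eq_zero
    (sub_nonneg.2 (hle (dualStep_subset_Icc hB (dualSet_subset_Icc hB n y) hK))) fun v hv => ?_
  obtain ⟨f, hf, rfl⟩ := hK
  rw [sub_mulVec, one_mulVec, sub_eq_zero] at hv
  have hfix := mul_kraus_mul_eq_of_sum_mul_eq y (C := vecMulVec v (star v))
    (fun k => hle (dualSet_subset_Icc hB n y (hf k))) (by rw [mul_vecMulVec, ← hv])
  have hzero (k) : M.kraus y k * vecMulVec v (star v) = 0 := by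
    by_contra hne
    obtain ⟨φ, η, hA⟩ := hR y k
    refine hn y k (left_ne_zero_of_mul hne) (canAvoid_of_mul_kraus_eq hB hR (hf k) ?_)
    change ∀ i : Fin (M.fam y).len, i = k → _
    rintro i rfl
    exact mul_eq_self_of_rankOne hA hne (hfix i)
  have hvv : vecMulVec v (star v) = 0 := by
    rw [← one_mul (vecMulVec v (star v)), ← M.sum_kraus y, Finset.sum_mul]
    exact Finset.sum_eq_zero fun k _ => by rw [mul_assoc, hzero, mul_zero]
  simpa using congrArg trace hvv

theorem exists_pos_forall_dualStep_le (hB : M.Invariant B) (hR : M.RankOneKraus) {n : ℕ}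
    (hn : ∀ x i, M.kraus x i ≠ 0 → ¬ M.CanAvoid B n ⟨x, {i}⟩) :
    ∃ ε > 0, ∀ y, ∀ K ∈ M.dualStep y (M.dualSet B n y),
      K ≤ (1 - ε : ℝ) • (1 - projMatrix B) := by
  have hsmall (y) (K) (hK : K ∈ M.dualStep y (M.dualSet B n y)) :
      ∀ᶠ ε : ℝ in 𝓝[>] 0, K ≤ (1 - ε) • (1 - projMatrix B) := by
    obtain ⟨δ, hδ, hle⟩ := exists_pos_smul_one_le (posDef_one_sub_of_mem_dualStep hB hR hn hK)
    filter_upwards [Ioc_mem_nhdsGT hδ] with ε hε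
    refine le_smul_of_smul_one_le_one_sub (isStarProjection_projMatrix B).one_sub
      (dualStep_subset_Icc hB (dualSet_subset_Icc hB n y) hK) (le_trans ?_ hle)
    exact smul_le_smul_of_nonneg_right hε.2 zero_le_one
  have hall : ∀ᶠ ε : ℝ in 𝓝[>] 0, ∀ y, ∀ K ∈ M.dualStep y (M.dualSet B n y),
      K ≤ (1 - ε) • (1 - projMatrix B) :=
    eventually_all.2 fun y =>
      (eventually_all_finite (M.finite_dualStep y (M.finite_dualSet B n y))).2 (hsmall y)
  obtain ⟨ε, hε, h⟩ := ((eventually_mem_nhdsWithin (s := Set.Ioi 0)).and hall).exists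
  exact ⟨ε, hε, h⟩

theorem expect_add_succ_le {S : M.Scheduler} (hS : M.Admissible S)
    {ρ : Matrix (Fin M.dim) (Fin M.dim) ℂ} (hρ : ρ.PosSemidef) {n : ℕ} {δ : ℝ}
    (h : ∀ y, ∀ K ∈ M.dualStep y (M.dualSet B n y), K ≤ δ • (1 - projMatrix B)) (m : ℕ) :
    (M.expect S ρ (1 - projMatrix B) (m + (n + 1)) 0).re ≤
      δ * (M.expect S ρ (1 - projMatrix B) m 0).re := by
  rw [expect_add hρ, expect, expect, Complex.re_sum, Complex.re_sum, Finset.mul_sum]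
  refine Finset.sum_le_sum fun w _ => ?_
  by_cases hw : M.Consistent S (List.ofFn w)
  · have hle := trace_mul_le_trace_mul (h _ _ (dual_mem_dualStep hS n hw))
      (weightedState_nonneg (S := S) hρ (List.ofFn w))
    rw [smul_mul_assoc, trace_smul] at hle
    simpa [dual] using (Complex.le_def.1 hle).1
  · simp [weightedState_eq_zero hρ hw]

end Dual

theorem tendsto_zero_of_antitone_of_le_mul {r : ℕ → ℝ} (hanti : Antitone r) (h0 : ∀ m, 0 ≤ r m)
    {δ : ℝ} (hδ : δ < 1) {l : ℕ} (h : ∀ m, r (m + l) ≤ δ * r m) : Tendsto r atTop (𝓝 0) := by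
  have hlim := tendsto_atTop_ciInf hanti ⟨0, by rintro _ ⟨m, rfl⟩; exact h0 m⟩
  have hle : (⨅ m, r m) ≤ δ * ⨅ m, r m :=
    le_of_tendsto_of_tendsto' ((tendsto_add_atTop_iff_nat l).2 hlim) (hlim.const_mul _) h
  have hge : 0 ≤ ⨅ m, r m := le_ciInf h0
  rwa [show (⨅ m, r m) = 0 by nlinarith] at hlim

section Criterion

variable {M : QMDP} {B : Submodule ℂ (EuclideanSpace ℂ (Fin M.dim))}

theorem exists_forall_not_canAvoid
    (h : ∀ x i, M.kraus x i ≠ 0 → ∃ n, ¬ M.CanAvoid B n ⟨x, {i}⟩) :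
    ∃ n, ∀ x i, M.kraus x i ≠ 0 → ¬ M.CanAvoid B n ⟨x, {i}⟩ := by
  choose! m hm using h
  refine ⟨Finset.univ.sup fun x => Finset.univ.sup (m x), fun x i hne hc => hm x i hne ?_⟩
  refine antitone_canAvoid B _ ?_ hc
  exact (Finset.le_sup (f := m x) (Finset.mem_univ i)).trans
    (Finset.le_sup (f := fun x => Finset.univ.sup (m x)) (Finset.mem_univ x))

theorem alwaysReaches_of_not_canAvoid (hB : M.Invariant B) (hR : M.RankOneKraus)
    (h : ∀ x i, M.kraus x i ≠ 0 → ∃ n, ¬ M.CanAvoid B n ⟨x, {i}⟩) : M.AlwaysReaches B := by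
  intro S hS ρ hρ
  obtain ⟨n, hn⟩ := exists_forall_not_canAvoid h
  obtain ⟨ε, hε, hcontr⟩ := exists_pos_forall_dualStep_le hB hR hn
  have hanti : Antitone fun m => (M.expect S ρ (1 - projMatrix B) m 0).re := by
    refine antitone_nat_of_succ_le fun m => ?_
    simpa only [one_mul] using expect_add_succ_le hS hρ.1 (n := 0) (δ := 1) (fun y K hK => by
      simpa only [one_smul] using (dualStep_subset_Icc hB (dualSet_subset_Icc hB 0 y) hK).2) m
  have hnonneg (m : ℕ) : 0 ≤ (M.expect S ρ (1 - projMatrix B) m 0).re :=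
    (Complex.nonneg_iff.1 (Finset.sum_nonneg fun w _ => trace_mul_nonneg
      (isStarProjection_projMatrix B).one_sub_nonneg (weightedState_nonneg hρ.1 _))).1
  have hlim := tendsto_zero_of_antitone_of_le_mul hanti hnonneg (sub_lt_self 1 hε)
    (expect_add_succ_le hS hρ.1 hcontr)
  rw [HasReachProb, funext (probAt_eq S hρ B)]
  simpa only [sub_zero] using hlim.const_sub 1

theorem alwaysReaches_iff (hB : M.Invariant B) (hR : M.RankOneKraus) :
    M.AlwaysReaches B ↔ ¬ ∃ x i, M.kraus x i ≠ 0 ∧ ∀ n, M.CanAvoid B n ⟨x, {i}⟩ := by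
  refine ⟨?_, fun h => alwaysReaches_of_not_canAvoid hB hR fun x i hne => ?_⟩
  · rintro h ⟨x, i, hne, hc⟩
    exact not_alwaysReaches_of_canAvoid hR hne hc h
  · by_contra! hc
    exact h ⟨x, i, hne, hc⟩

end Criterion

end QMDP

/-! ### Formulas -/

namespace RealRAM

namespace NatTerm

/-- A term regarded as a formula holds if its value is not zero. -/
def Holds (G : Tables) (v : ℕ → ℕ) (e : NatTerm) : Prop := e.eval G v ≠ 0

/-- Negation. -/
def neg (e : NatTerm) : NatTerm := .sub (.lit 1) e

/-- Conjunction. -/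
def conj (e f : NatTerm) : NatTerm := neg (.add (neg e) (neg f))

/-- Implication. -/
def imp (e f : NatTerm) : NatTerm := .add (neg e) f

/-- Comparison, by means of truncated subtraction. -/
def lt (e f : NatTerm) : NatTerm := .sub f e

/-- Equality of numbers, by means of truncated subtraction. -/
def eq (e f : NatTerm) : NatTerm := neg (.add (.sub e f) (.sub f e))

/-- Equivalence. -/
def iff (e f : NatTerm) : NatTerm := eq (neg e) (neg f)

/-- Existence of a number `x < r` with `e`. -/
def ex (x : ℕ) (r e : NatTerm) : NatTerm := .sum x r e

/-- Bounded universal quantification. -/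
def all (x : ℕ) (r e : NatTerm) : NatTerm := neg (ex x r (neg e))

/-- Multiplication, as a sum over variable `10`, which must not occur in `f`. -/
def mul (e f : NatTerm) : NatTerm := .sum 10 e f

variable {G : Tables} {v : ℕ → ℕ} {e f r : NatTerm} {x n : ℕ}

@[simp] theorem holds_neg : (neg e).Holds G v ↔ ¬ e.Holds G v := by
  simp only [Holds, neg, eval]
  omega

@[simp] theorem holds_add : (add e f).Holds G v ↔ e.Holds G v ∨ f.Holds G v := by
  simp only [Holds, eval]
  omega

@[simp] theorem holds_conj : (conj e f).Holds G v ↔ e.Holds G v ∧ f.Holds G v := by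
  simp only [conj, holds_neg, holds_add]
  tauto

@[simp] theorem holds_imp : (imp e f).Holds G v ↔ (e.Holds G v → f.Holds G v) := by
  simp only [imp, holds_add, holds_neg]
  tauto

@[simp] theorem holds_lt : (lt e f).Holds G v ↔ e.eval G v < f.eval G v := by
  simp only [Holds, lt, eval]
  omega

@[simp] theorem holds_eq : (eq e f).Holds G v ↔ e.eval G v = f.eval G v := by
  simp only [Holds, eq, neg, eval]
  omega

@[simp] theorem holds_iff : (iff e f).Holds G v ↔ (e.Holds G v ↔ f.Holds G v) := by
  rw [iff, holds_eq]
  simp only [neg, eval, Holds]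
  omega

@[simp] theorem holds_read {a : Fin 4} : (read a e).Holds G v ↔ G.nat a (e.eval G v) ≠ 0 := by
  simp only [Holds, eval]

@[simp] theorem holds_nonzero {y : RealTerm} : (nonzero y).Holds G v ↔ y.eval G v ≠ 0 := by
  simp [Holds, eval]

theorem holds_ex (hr : r.eval G v = n) (hn : n ≤ G.bound) :
    (ex x r e).Holds G v ↔ ∃ i < n, e.Holds G (Function.update v x i) := by
  simp [ex, Holds, eval, hr, hn, Finset.sum_eq_zero_iff]

theorem holds_all (hr : r.eval G v = n) (hn : n ≤ G.bound) :
    (all x r e).Holds G v ↔ ∀ i < n, e.Holds G (Function.update v x i) := by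
  simp [all, holds_ex hr hn]

theorem eval_mul {m : ℕ} (he : e.eval G v = m) (hm : m ≤ G.bound)
    (hf : ∀ i, f.eval G (Function.update v 10 i) = n) : (mul e f).eval G v = m * n := by
  simp [mul, eval, he, hm, hf]

end NatTerm

/-- A term for a complex number. -/
structure ComplexTerm where
  re : RealTerm
  im : RealTerm

/-- The `i`-th complex number in table `a`, which holds real and imaginary parts alternately. -/
def Tables.complex (G : Tables) (a : Fin 2) (i : ℕ) : ℂ :=
  ⟨G.real a (2 * i), G.real a (2 * i + 1)⟩

namespace ComplexTerm

/-- The value of a term for a complex number. -/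
noncomputable def eval (G : Tables) (v : ℕ → ℕ) (z : ComplexTerm) : ℂ :=
  ⟨z.re.eval G v, z.im.eval G v⟩

/-- An access to `Tables.complex`. -/
def read (a : Fin 2) (e : NatTerm) : ComplexTerm :=
  ⟨.read a (.add e e), .read a (.add (.add e e) (.lit 1))⟩

/-- Multiplication. -/
def mul (z w : ComplexTerm) : ComplexTerm :=
  ⟨.sub (.mul z.re w.re) (.mul z.im w.im), .add (.mul z.re w.im) (.mul z.im w.re)⟩

/-- Summation. -/
def sum (x : ℕ) (r : NatTerm) (z : ComplexTerm) : ComplexTerm := ⟨.sum x r z.re, .sum x r z.im⟩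

/-- The formula that the number is not zero. -/
def nonzero (z : ComplexTerm) : NatTerm := .add (.nonzero z.re) (.nonzero z.im)

variable {G : Tables} {v : ℕ → ℕ}

theorem eval_read (a : Fin 2) (e : NatTerm) :
    (read a e).eval G v = G.complex a (e.eval G v) := by
  simp only [eval, read, RealTerm.eval, NatTerm.eval, Tables.complex, two_mul]

theorem eval_mul (z w : ComplexTerm) : (z.mul w).eval G v = z.eval G v * w.eval G v := by
  apply Complex.ext <;> simp [eval, mul, RealTerm.eval]

theorem eval_sum {x n : ℕ} {r : NatTerm} (hr : r.eval G v = n) (hn : n ≤ G.bound)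
    (z : ComplexTerm) :
    (sum x r z).eval G v = ∑ i : Fin n, z.eval G (Function.update v x i) := by
  rw [Fin.sum_univ_eq_sum_range fun i => z.eval G (Function.update v x i)]
  apply Complex.ext <;> simp [eval, sum, RealTerm.eval, hr, hn]

theorem holds_nonzero {z : ComplexTerm} : z.nonzero.Holds G v ↔ z.eval G v ≠ 0 := by
  simp only [nonzero, NatTerm.holds_add, NatTerm.holds_nonzero, eval, Ne, Complex.ext_iff,
    Complex.zero_re, Complex.zero_im, not_and_or]

end ComplexTerm

end RealRAM

/-! ### The numbering of choices and sets of operators -/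

namespace QMDP

open RealRAM

/-- The position of a choice in `QMDP.choices`. -/
def code (M : QMDP) (x : M.Choice) : ℕ := (finSumFinEquiv x : Fin (M.numAct + M.numMeas))

theorem code_lt (M : QMDP) (x : M.Choice) : M.code x < M.numAct + M.numMeas :=
  (finSumFinEquiv x).2

theorem code_injective (M : QMDP) : Function.Injective M.code := fun _ _ h =>
  finSumFinEquiv.injective (Fin.ext h)

theorem exists_lt_iff_exists_code (M : QMDP) {p : ℕ → Prop} :
    (∃ i < M.numAct + M.numMeas, p i) ↔ ∃ x, p (M.code x) :=
  ⟨fun ⟨i, hi, h⟩ => ⟨finSumFinEquiv.symm ⟨i, hi⟩, by simpa [code] using h⟩,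
    fun ⟨x, h⟩ => ⟨_, M.code_lt x, h⟩⟩

theorem ev_eq_ev_iff (M : QMDP) (x : M.Choice) (k k' : Fin (M.fam x).len) :
    M.ev x k' = M.ev x k ↔ M.code x < M.numAct ∨ k' = k := by
  match x with
  | Sum.inl α => simp [ev, code]
  | Sum.inr β =>
    simp only [ev, code, Sum.inr.injEq, finSumFinEquiv_apply_right, Fin.val_natAdd,
      not_lt.2 (Nat.le_add_right _ _), false_or]
    exact sigma_mk_injective.eq_iff

theorem len_le_maxLen (M : QMDP) (x : M.Choice) : (M.fam x).len ≤ M.maxLen :=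
  Finset.le_sup (f := fun x => (M.fam x).len) (Finset.mem_univ x)

/-- The choice `x` together with the set of operators given by the binary digits of `c`. -/
def codeNode (M : QMDP) (x : M.Choice) (c : ℕ) : M.Node := ⟨x, {i | c.testBit i}⟩

theorem codeNode_eq_mk_iff {M : QMDP} {x : M.Choice} {c : ℕ} {S : Set (Fin (M.fam x).len)} :
    M.codeNode x c = ⟨x, S⟩ ↔ ∀ i : Fin (M.fam x).len, c.testBit i ↔ i ∈ S :=
  sigma_mk_injective.eq_iff.trans Set.ext_iff

theorem exists_codeNode_eq (M : QMDP) (x : M.Choice) (S : Set (Fin (M.fam x).len)) :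
    ∃ c < 2 ^ M.maxLen, M.codeNode x c = ⟨x, S⟩ := by
  classical
  refine ⟨Nat.ofBits fun i => decide (i ∈ S), (Nat.ofBits_lt_two_pow _).trans_le
    (Nat.pow_le_pow_right two_pos (M.len_le_maxLen x)), ?_⟩
  simp [codeNode]

theorem codeNode_two_pow (M : QMDP) (x : M.Choice) (i : Fin (M.fam x).len) :
    M.codeNode x (2 ^ i.1) = ⟨x, {i}⟩ := by
  rw [codeNode_eq_mk_iff]
  intro k
  rw [Nat.testBit_two_pow, decide_eq_true_eq, Fin.val_inj, Set.mem_singleton_iff, eq_comm]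

theorem canAvoid_succ_codeNode {M : QMDP} {B : Submodule ℂ (EuclideanSpace ℂ (Fin M.dim))} (n : ℕ)
    (x : M.Choice) (c : ℕ) :
    M.CanAvoid B (n + 1) (M.codeNode x c) ↔
      (∀ i : Fin (M.fam x).len, c.testBit i → projMatrix B * M.kraus x i = 0) ∧
      ∃ y ∈ M.avail x, ∀ k : Fin (M.fam y).len, ∃ c' < 2 ^ M.maxLen,
        M.CanAvoid B n (M.codeNode y c') ∧ ∀ k' : Fin (M.fam y).len, c'.testBit k' ↔
          (∃ i : Fin (M.fam x).len, c.testBit i ∧ M.kraus y k' * M.kraus x i ≠ 0) ∧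
          M.ev y k' = M.ev y k := by
  refine and_congr_right fun _ => exists_congr fun y => and_congr_right fun _ =>
    forall_congr' fun k => ?_
  rw [step_ev]
  constructor
  · intro h
    obtain ⟨c', hc', hν⟩ := M.exists_codeNode_eq y _
    exact ⟨c', hc', hν ▸ h, codeNode_eq_mk_iff.1 hν⟩
  · rintro ⟨c', -, h, hbits⟩
    rwa [codeNode_eq_mk_iff.2 hbits] at h

end QMDP

namespace QMDP

open RealRAM NatTerm

variable {M : QMDP} {B : Submodule ℂ (EuclideanSpace ℂ (Fin M.dim))}

/-! ### Stabilization -/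

theorem card_node (M : QMDP) : Nat.card M.Node = ∑ x, 2 ^ (M.fam x).len := by
  simp [Nat.card_eq_fintype_card, Fintype.card_sigma]

theorem card_node_le (M : QMDP) :
    Nat.card M.Node ≤ (M.numAct + M.numMeas) * 2 ^ M.maxLen := by
  rw [card_node]
  refine (Finset.sum_le_card_nsmul _ _ (2 ^ M.maxLen) fun x _ =>
    Nat.pow_le_pow_right two_pos (M.len_le_maxLen x)).trans_eq ?_
  simp

theorem canAvoid_succ_eq {m n : ℕ} (h : M.CanAvoid B m = M.CanAvoid B n) :
    M.CanAvoid B (m + 1) = M.CanAvoid B (n + 1) := by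
  ext ν
  simp only [CanAvoid, h]

theorem forall_canAvoid {n : ℕ} {ν : M.Node} (hn : Nat.card M.Node ≤ n)
    (h : M.CanAvoid B n ν) (m : ℕ) : M.CanAvoid B m ν := by
  let lost (m : ℕ) : Set M.Node := {ν | ¬ M.CanAvoid B m ν}
  have hmono : Monotone lost := fun _ _ hmm _ hν hc => hν (antitone_canAvoid B _ hmm hc)
  have hsub {m m' : ℕ} (hle : m ≤ m') (hcard : (lost m').ncard ≤ (lost m).ncard) :
      M.CanAvoid B m = M.CanAvoid B m' :=
    compl_injective (Set.eq_of_subset_of_ncard_le (hmono hle) hcard)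
  have hstable {m' : ℕ} (hm' : Nat.card M.Node ≤ m') :
      (lost m').ncard = (lost (Nat.card M.Node)).ncard :=
    Nat.stabilises_of_monotone (f := fun m => (lost m).ncard)
      (fun _ _ hle => Set.ncard_le_ncard (hmono hle)) (fun m => Set.ncard_le_card (lost m))
      (fun m hm => by
        have := canAvoid_succ_eq (hsub m.le_succ hm.ge)
        simp only [lost, this]) hm'
  have heq := hsub (le_max_left n m)
    ((hstable (hn.trans (le_max_left n m))).trans (hstable hn).symm).le
  exact antitone_canAvoid B ν (le_max_right n m) ((congrFun heq ν).mp h)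

theorem dim_le_len (hR : M.RankOneKraus) (x : M.Choice) : M.dim ≤ (M.fam x).len := by
  choose φ η h using hR x
  let η' : Matrix (Fin (M.fam x).len) (Fin M.dim) ℂ := of η
  have hinj : Function.Injective η'.mulVecLin := by
    rw [← LinearMap.ker_eq_bot, LinearMap.ker_eq_bot']
    intro v hv
    have hkraus (k) : M.kraus x k *ᵥ v = 0 := by
      have hη : η k ⬝ᵥ v = 0 := congrFun hv k
      rw [h k, vecMulVec_mulVec, hη, MulOpposite.op_zero, zero_smul]
    rw [← one_mulVec v, ← M.sum_kraus x, sum_mulVec]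
    exact Finset.sum_eq_zero fun k _ => by rw [← mulVec_mulVec, hkraus, mulVec_zero]
  simpa using LinearMap.finrank_le_finrank_of_injective hinj

/-! ### Formulas about a process -/

/-- The tables of numbers of `G` hold the dimension, the numbers of actions and of measurements,
the bound `(|Act| + |𝐌|) 2 ^ N` and the powers of two (table `0`), the numbers of operators (`1`),
and the map `Q` (`2`); the tables of reals hold the projection onto `B` and the operators, as in
`QMDP.inputStore`. -/
structure EncodedBy (M : QMDP) (B : Submodule ℂ (EuclideanSpace ℂ (Fin M.dim))) (G : Tables) :
    Prop where
  dim : G.nat 0 0 = M.dim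
  numAct : G.nat 0 1 = M.numAct
  numMeas : G.nat 0 2 = M.numMeas
  bound : G.bound = (M.numAct + M.numMeas) * 2 ^ M.maxLen
  twoPow : G.nat 0 4 = 2 ^ M.maxLen
  pow : ∀ i < M.maxLen, G.nat 0 (5 + i) = 2 ^ i
  len : ∀ x, G.nat 1 (M.code x) = (M.fam x).len
  avail : ∀ x y, G.nat 2 ((M.numAct + M.numMeas) * M.code x + M.code y) ≠ 0 ↔ y ∈ M.avail x
  proj : ∀ r c : Fin M.dim, G.complex 0 (M.dim * r + c) = projMatrix B r c
  op : ∀ x (k : Fin (M.fam x).len) (r c : Fin M.dim),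
    G.complex 1 (M.dim * (M.dim * (∑ z ∈ Finset.range (M.code x), G.nat 1 z + k) + r) + c) =
      M.kraus x k r c

/-- The dimension. -/
def dimTerm : NatTerm := .read 0 (.lit 0)

/-- The number of actions. -/
def numActTerm : NatTerm := .read 0 (.lit 1)

/-- The number of choices. -/
def numChoicesTerm : NatTerm := .add numActTerm (.read 0 (.lit 2))

/-- The number `2 ^ N` of codes of sets of operators. -/
def twoPowTerm : NatTerm := .read 0 (.lit 4)

/-- The number `2 ^ i`. -/
def powTerm (i : ℕ) : NatTerm := .read 0 (.add (.lit 5) (.var i))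

/-- The number of operators of the choice `x`. -/
def lenTerm (x : ℕ) : NatTerm := .read 1 (.var x)

/-- The entry of the projection in row `r` and column `c`. -/
def projEntry (r c : ℕ) : ComplexTerm := .read 0 (.add (mul dimTerm (.var r)) (.var c))

/-- The entry in row `r` and column `c` of the operator `k` of the choice `x`. -/
def opEntry (x k r c : ℕ) : ComplexTerm :=
  .read 1 (.add (mul dimTerm (.add (mul dimTerm
    (.add (.sum 11 (.var x) (lenTerm 11)) (.var k))) (.var r))) (.var c))

/-- The formula that a matrix is not zero whose entry in row `12` and column `13` is `z`. -/
def matrixNonzero (z : ComplexTerm) : NatTerm := ex 12 dimTerm (ex 13 dimTerm z.nonzero)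

/-- The formula that the projection does not annihilate the operator `k` of the choice `x`. -/
def projMulOpNonzero (x k : ℕ) : NatTerm :=
  matrixNonzero (.sum 14 dimTerm ((projEntry 12 14).mul (opEntry x k 14 13)))

/-- The formula that the operator `l` of the choice `y` does not annihilate the operator `k` of the
choice `x`. -/
def opMulOpNonzero (y l x k : ℕ) : NatTerm :=
  matrixNonzero (.sum 14 dimTerm ((opEntry y l 12 14).mul (opEntry x k 14 13)))

theorem testBit_iff_exists {b c i : ℕ} (hc : c < b) :
    c.testBit i ↔ ∃ p < b, ∃ q < 2 ^ i, c = 2 ^ i * (2 * p + 1) + q := by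
  rw [Nat.testBit_eq_decide_div_mod_eq, decide_eq_true_iff]
  constructor
  · intro h
    have hdiv : c / 2 ^ i ≤ c := Nat.div_le_self c _
    refine ⟨c / 2 ^ i / 2, by omega, c % 2 ^ i, Nat.mod_lt _ (by positivity), ?_⟩
    rw [show 2 * (c / 2 ^ i / 2) + 1 = c / 2 ^ i by omega, Nat.div_add_mod]
  · rintro ⟨p, -, q, hq, rfl⟩
    rw [Nat.mul_add_div (by positivity), Nat.div_eq_of_lt hq, add_zero, Nat.mul_add_mod]

/-- The formula that the binary digit `i` of `c` is one: `c = 2 ^ i * (2 * p + 1) + q` for some `p`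
and some `q < 2 ^ i`. -/
def testBitTerm (c i : ℕ) : NatTerm :=
  ex 15 twoPowTerm (ex 16 (powTerm i) (eq (.var c)
    (.add (mul (powTerm i) (.add (.add (.var 15) (.var 15)) (.lit 1))) (.var 16))))

/-- The entry of the table of lost nodes for the choice `x` and the set coded by `c`. -/
def lossTerm (x : ℕ) (c : NatTerm) : NatTerm := .read 3 (.add (mul twoPowTerm (.var x)) c)

namespace EncodedBy

variable {G : Tables} {v : ℕ → ℕ} {x : M.Choice}

theorem numChoices_le (hE : M.EncodedBy B G) : M.numAct + M.numMeas ≤ G.bound :=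
  hE.bound ▸ Nat.le_mul_of_pos_right _ (by positivity)

theorem twoPow_le (hE : M.EncodedBy B G) (x : M.Choice) : 2 ^ M.maxLen ≤ G.bound :=
  hE.bound ▸ Nat.le_mul_of_pos_left _ (Nat.zero_lt_of_lt (M.code_lt x))

theorem len_le (hE : M.EncodedBy B G) (x : M.Choice) : (M.fam x).len ≤ G.bound :=
  (M.len_le_maxLen x).trans (Nat.lt_two_pow_self.le.trans (hE.twoPow_le x))

theorem dim_le (hE : M.EncodedBy B G) (hR : M.RankOneKraus) (x : M.Choice) :
    M.dim ≤ G.bound :=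
  (dim_le_len hR x).trans (hE.len_le x)

theorem eval_dimTerm (hE : M.EncodedBy B G) : dimTerm.eval G v = M.dim := hE.dim

theorem eval_numActTerm (hE : M.EncodedBy B G) : numActTerm.eval G v = M.numAct := hE.numAct

theorem eval_numChoicesTerm (hE : M.EncodedBy B G) :
    numChoicesTerm.eval G v = M.numAct + M.numMeas :=
  congrArg₂ (· + ·) hE.numAct hE.numMeas

theorem eval_twoPowTerm (hE : M.EncodedBy B G) : twoPowTerm.eval G v = 2 ^ M.maxLen := hE.twoPow

theorem eval_powTerm (hE : M.EncodedBy B G) {a i : ℕ} (ha : v a = i) (hi : i < M.maxLen) :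
    (powTerm a).eval G v = 2 ^ i := by
  rw [powTerm, eval, eval, eval, eval, ha, hE.pow i hi]

theorem eval_lenTerm (hE : M.EncodedBy B G) {a : ℕ} (ha : v a = M.code x) :
    (lenTerm a).eval G v = (M.fam x).len := by
  rw [lenTerm, eval, eval, ha, hE.len]

theorem holds_ex_choice (hE : M.EncodedBy B G) {a : ℕ} {e : NatTerm} :
    (ex a numChoicesTerm e).Holds G v ↔
      ∃ x, e.Holds G (Function.update v a (M.code x)) := by
  rw [holds_ex hE.eval_numChoicesTerm hE.numChoices_le, M.exists_lt_iff_exists_code]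

theorem holds_ex_op (hE : M.EncodedBy B G) {a i : ℕ} {e : NatTerm} (ha : v a = M.code x) :
    (ex i (lenTerm a) e).Holds G v ↔
      ∃ k : Fin (M.fam x).len, e.Holds G (Function.update v i k) := by
  simp only [holds_ex (hE.eval_lenTerm ha) (hE.len_le x), Fin.exists_iff, exists_prop]

theorem holds_all_op (hE : M.EncodedBy B G) {a i : ℕ} {e : NatTerm} (ha : v a = M.code x) :
    (all i (lenTerm a) e).Holds G v ↔
      ∀ k : Fin (M.fam x).len, e.Holds G (Function.update v i k) := by
  simp only [holds_all (hE.eval_lenTerm ha) (hE.len_le x), Fin.forall_iff]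

theorem holds_testBitTerm (hE : M.EncodedBy B G) (x : M.Choice) {a b c i : ℕ} (ha : a < 10)
    (hb : b < 10) (hva : v a = c) (hvb : v b = i) (hc : c < 2 ^ M.maxLen) (hi : i < M.maxLen) :
    (testBitTerm a b).Holds G v ↔ c.testBit i := by
  have hpow : 2 ^ i ≤ G.bound := (Nat.pow_le_pow_right two_pos hi.le).trans (hE.twoPow_le x)
  have hmul (w : ℕ → ℕ) (hw : w b = i) : (mul (powTerm b)
      (.add (.add (.var 15) (.var 15)) (.lit 1))).eval G w = 2 ^ i * (2 * w 15 + 1) :=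
    eval_mul (hE.eval_powTerm hw hi) hpow fun j => by simp [eval, two_mul]
  rw [testBit_iff_exists hc, testBitTerm, holds_ex hE.eval_twoPowTerm (hE.twoPow_le x)]
  refine exists_congr fun p => and_congr_right fun _ => ?_
  rw [holds_ex (n := 2 ^ i) (hE.eval_powTerm ?_ hi) hpow]
  · refine exists_congr fun q => and_congr_right fun _ => ?_
    rw [holds_eq, eval, eval, hmul]
    · simp (disch := omega) only [eval, Function.update_of_ne, Function.update_self, hva]
    · simp (disch := omega) only [Function.update_of_ne, hvb]
  · rw [Function.update_of_ne (by omega), hvb]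

theorem holds_matrixNonzero (hE : M.EncodedBy B G) (hd : M.dim ≤ G.bound) {z : ComplexTerm}
    {A : Matrix (Fin M.dim) (Fin M.dim) ℂ}
    (h : ∀ r c : Fin M.dim,
      z.eval G (Function.update (Function.update v 12 r) 13 c) = A r c) :
    (matrixNonzero z).Holds G v ↔ A ≠ 0 := by
  simp only [matrixNonzero, holds_ex hE.eval_dimTerm hd, ComplexTerm.holds_nonzero, Ne,
    ← Matrix.ext_iff, not_forall, Fin.exists_iff, exists_prop, Matrix.zero_apply, ← h]

theorem eval_projEntry (hE : M.EncodedBy B G) (hd : M.dim ≤ G.bound) {a b : ℕ} (ha : 10 < a)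
    {r c : Fin M.dim} (hr : v a = r) (hc : v b = c) :
    (projEntry a b).eval G v = projMatrix B r c := by
  rw [projEntry, ComplexTerm.eval_read, eval, eval_mul (n := r) hE.eval_dimTerm hd fun i => ?_,
    eval, hc, hE.proj]
  rw [eval, Function.update_of_ne ha.ne', hr]

theorem eval_opEntry (hE : M.EncodedBy B G) (hd : M.dim ≤ G.bound) {y l a b : ℕ} (hy : y < 10)
    (hl : l < 10) (ha : 11 < a) {k : Fin (M.fam x).len} {r c : Fin M.dim} (hx : v y = M.code x)
    (hk : v l = k) (hr : v a = r) (hc : v b = c) :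
    (opEntry y l a b).eval G v = M.kraus x k r c := by
  have hcode : M.code x ≤ G.bound := (M.code_lt x).le.trans hE.numChoices_le
  have hrow (i : ℕ) : (NatTerm.add (mul dimTerm (.add (.sum 11 (.var y) (lenTerm 11)) (.var l)))
      (.var a)).eval G (Function.update v 10 i) =
        M.dim * (∑ z ∈ Finset.range (M.code x), G.nat 1 z + k) + r := by
    rw [eval, eval_mul hE.eval_dimTerm hd fun j => ?_, eval, Function.update_of_ne (by omega), hr]
    simp (disch := omega) only [eval, Function.update_of_ne, hx, hk, min_eq_left hcode, lenTerm,
      Function.update_self]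
  rw [opEntry, ComplexTerm.eval_read, eval, eval_mul hE.eval_dimTerm hd hrow, eval, hc, hE.op]

theorem holds_projMulOpNonzero (hE : M.EncodedBy B G) (hd : M.dim ≤ G.bound) {a b : ℕ}
    (ha : a < 10) (hb : b < 10) {k : Fin (M.fam x).len} (hx : v a = M.code x) (hk : v b = k) :
    (projMulOpNonzero a b).Holds G v ↔ projMatrix B * M.kraus x k ≠ 0 := by
  refine hE.holds_matrixNonzero hd fun r c => ?_
  rw [ComplexTerm.eval_sum hE.eval_dimTerm hd, mul_apply]
  refine Finset.sum_congr rfl fun j _ => ?_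
  rw [ComplexTerm.eval_mul, hE.eval_projEntry hd, hE.eval_opEntry hd ha hb]
  all_goals simp (disch := omega) [Function.update_of_ne, hx, hk]

theorem holds_opMulOpNonzero (hE : M.EncodedBy B G) (hd : M.dim ≤ G.bound) {y : M.Choice}
    {a b a' b' : ℕ} (ha : a < 10) (hb : b < 10) (ha' : a' < 10) (hb' : b' < 10)
    {l : Fin (M.fam y).len} {k : Fin (M.fam x).len} (hy : v a = M.code y) (hl : v b = l)
    (hx : v a' = M.code x) (hk : v b' = k) :
    (opMulOpNonzero a b a' b').Holds G v ↔ M.kraus y l * M.kraus x k ≠ 0 := by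
  refine hE.holds_matrixNonzero hd fun r c => ?_
  rw [ComplexTerm.eval_sum hE.eval_dimTerm hd, mul_apply]
  refine Finset.sum_congr rfl fun j _ => ?_
  rw [ComplexTerm.eval_mul, hE.eval_opEntry hd ha hb, hE.eval_opEntry hd ha' hb']
  all_goals simp (disch := omega) [Function.update_of_ne, hy, hl, hx, hk]

theorem holds_lossTerm (hE : M.EncodedBy B G) {a c : ℕ} {e : NatTerm} (ha : a < 10)
    (hx : v a = M.code x) (he : e.eval G v = c) :
    (lossTerm a e).Holds G v ↔ G.nat 3 (2 ^ M.maxLen * M.code x + c) ≠ 0 := by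
  rw [lossTerm, holds_read, eval, he,
    eval_mul (n := M.code x) hE.eval_twoPowTerm (hE.twoPow_le x) fun i => ?_]
  rw [eval, Function.update_of_ne ha.ne, hx]

end EncodedBy

/-! ### Deciding which nodes can avoid the subspace -/

/-- The formula that all operators in the set `1` of the choice `0` are annihilated by the
projection. -/
def safeTerm : NatTerm :=
  all 6 (lenTerm 0) (imp (testBitTerm 1 6) (neg (projMulOpNonzero 0 6)))

/-- The formula that the operator `5` of the choice `2` has a nonzero product with an operator in
the set `1` of the choice `0`. -/
def nextTerm : NatTerm :=
  ex 6 (lenTerm 0) (conj (testBitTerm 1 6) (opMulOpNonzero 2 5 0 6))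

/-- The formula that the operators `5` and `3` of the choice `2` produce the same event. -/
def sameEventTerm : NatTerm := .add (lt (.var 2) numActTerm) (eq (.var 5) (.var 3))

/-- The formula that the choice `0` with the set `1` can avoid the subspace for one step more than
the nodes that are not yet lost. -/
def avoidTerm : NatTerm :=
  conj safeTerm <| ex 2 numChoicesTerm <|
    conj (.read 2 (.add (mul numChoicesTerm (.var 0)) (.var 2))) <|
      all 3 (lenTerm 2) <| ex 4 twoPowTerm <| conj (neg (lossTerm 2 (.var 4))) <|
        all 5 (lenTerm 2) <| iff (testBitTerm 4 5) (conj nextTerm sameEventTerm)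

/-- The entry `7` of the next table of lost nodes. -/
def tableTerm : NatTerm :=
  neg <| ex 0 numChoicesTerm <| ex 1 twoPowTerm <|
    conj (eq (.var 7) (.add (mul twoPowTerm (.var 0)) (.var 1))) avoidTerm

/-- The formula that all nodes `⟨x, {i}⟩` with a nonzero operator `i` are lost. -/
def answerTerm : NatTerm :=
  neg <| ex 0 numChoicesTerm <| ex 6 (lenTerm 0) <|
    conj (matrixNonzero (opEntry 0 6 12 13)) (neg (lossTerm 0 (powTerm 6)))

/-- The number `j` is the position in the table of lost nodes of a node that can avoid the subspace
for `n` steps. -/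
def CanAvoidAt (M : QMDP) (B : Submodule ℂ (EuclideanSpace ℂ (Fin M.dim))) (n j : ℕ) : Prop :=
  ∃ x, ∃ c < 2 ^ M.maxLen, j = 2 ^ M.maxLen * M.code x + c ∧ M.CanAvoid B n (M.codeNode x c)

theorem canAvoidAt_iff {n c : ℕ} {x : M.Choice} (hc : c < 2 ^ M.maxLen) :
    M.CanAvoidAt B n (2 ^ M.maxLen * M.code x + c) ↔ M.CanAvoid B n (M.codeNode x c) := by
  refine ⟨?_, fun h => ⟨x, c, hc, rfl, h⟩⟩
  rintro ⟨y, c', hc', heq, h⟩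
  have hmod := congrArg (· % 2 ^ M.maxLen) heq
  obtain rfl : c = c' := by simpa [Nat.mul_add_mod, Nat.mod_eq_of_lt, hc, hc'] using hmod
  have hxy : x = y := M.code_injective (by simpa using heq)
  exact hxy ▸ h

theorem position_lt {c : ℕ} (x : M.Choice) (hc : c < 2 ^ M.maxLen) :
    2 ^ M.maxLen * M.code x + c < (M.numAct + M.numMeas) * 2 ^ M.maxLen :=
  calc 2 ^ M.maxLen * M.code x + c < 2 ^ M.maxLen * (M.code x + 1) := by rw [mul_add_one]; omega
    _ ≤ _ := by rw [mul_comm]; exact Nat.mul_le_mul_right _ (M.code_lt x)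

/-- The nonzero entries of `L` are those of the nodes that cannot avoid the subspace for `n`
steps. -/
def IsLossTable (M : QMDP) (B : Submodule ℂ (EuclideanSpace ℂ (Fin M.dim))) (n : ℕ)
    (L : ℕ → ℕ) : Prop :=
  ∀ j < (M.numAct + M.numMeas) * 2 ^ M.maxLen, L j = 0 ↔ M.CanAvoidAt B n j

theorem IsLossTable.eq_zero_iff {n c : ℕ} {L : ℕ → ℕ} (hL : M.IsLossTable B n L) (x : M.Choice)
    (hc : c < 2 ^ M.maxLen) :
    L (2 ^ M.maxLen * M.code x + c) = 0 ↔ M.CanAvoid B n (M.codeNode x c) :=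
  (hL _ (position_lt x hc)).trans (canAvoidAt_iff hc)

namespace EncodedBy

variable {G : Tables} {v : ℕ → ℕ} {x y : M.Choice} {c : ℕ}

theorem holds_safeTerm (hE : M.EncodedBy B G) (hd : M.dim ≤ G.bound) (hx : v 0 = M.code x)
    (hv : v 1 = c) (hc : c < 2 ^ M.maxLen) :
    safeTerm.Holds G v ↔
      ∀ i : Fin (M.fam x).len, c.testBit i → projMatrix B * M.kraus x i = 0 := by
  rw [safeTerm, hE.holds_all_op hx]
  refine forall_congr' fun i => ?_
  rw [holds_imp, holds_neg,
    hE.holds_testBitTerm x (c := c) (i := i) (by norm_num) (by norm_num) (by simpa) (by simp) hc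
      (i.2.trans_le (M.len_le_maxLen x)),
    hE.holds_projMulOpNonzero (x := x) (k := i) hd (by norm_num) (by norm_num) (by simpa)
      (by simp), not_not]

theorem holds_nextTerm (hE : M.EncodedBy B G) (hd : M.dim ≤ G.bound) (hx : v 0 = M.code x)
    (hv : v 1 = c) (hc : c < 2 ^ M.maxLen) (hy : v 2 = M.code y) {k' : Fin (M.fam y).len}
    (hk' : v 5 = k') :
    nextTerm.Holds G v ↔
      ∃ i : Fin (M.fam x).len, c.testBit i ∧ M.kraus y k' * M.kraus x i ≠ 0 := by
  rw [nextTerm, hE.holds_ex_op hx]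
  refine exists_congr fun i => ?_
  rw [holds_conj,
    hE.holds_testBitTerm x (c := c) (i := i) (by norm_num) (by norm_num) (by simpa) (by simp) hc
      (i.2.trans_le (M.len_le_maxLen x)),
    hE.holds_opMulOpNonzero (x := x) (k := i) (y := y) (l := k') hd (by norm_num) (by norm_num)
      (by norm_num) (by norm_num) (by simpa) (by simpa) (by simpa) (by simp)]

theorem holds_sameEventTerm (hE : M.EncodedBy B G) (hy : v 2 = M.code y)
    {k k' : Fin (M.fam y).len} (hk : v 3 = k) (hk' : v 5 = k') :
    sameEventTerm.Holds G v ↔ M.ev y k' = M.ev y k := by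
  rw [sameEventTerm, holds_add, holds_lt, holds_eq, hE.eval_numActTerm, eval, eval, eval, hy, hk,
    hk', Fin.val_inj, ev_eq_ev_iff]

theorem holds_avail (hE : M.EncodedBy B G) (hx : v 0 = M.code x) (hy : v 2 = M.code y) :
    (NatTerm.read 2 (.add (mul numChoicesTerm (.var 0)) (.var 2))).Holds G v ↔ y ∈ M.avail x := by
  rw [holds_read, eval, eval_mul (n := M.code x) hE.eval_numChoicesTerm hE.numChoices_le
    fun i => ?_, eval, hy, hE.avail]
  rw [eval, Function.update_of_ne (by norm_num), hx]

theorem holds_avoidTerm (hE : M.EncodedBy B G) (hd : M.dim ≤ G.bound) {n : ℕ}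
    (hL : M.IsLossTable B n (G.nat 3)) (hx : v 0 = M.code x) (hv : v 1 = c)
    (hc : c < 2 ^ M.maxLen) :
    avoidTerm.Holds G v ↔ M.CanAvoid B (n + 1) (M.codeNode x c) := by
  rw [avoidTerm, holds_conj, hE.holds_safeTerm hd hx hv hc, hE.holds_ex_choice,
    canAvoid_succ_codeNode]
  refine and_congr_right fun _ => exists_congr fun y => ?_
  rw [holds_conj, hE.holds_avail (x := x) (y := y) (by simpa) (by simp),
    hE.holds_all_op (x := y) (by simp)]
  refine and_congr_right fun _ => forall_congr' fun k => ?_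
  rw [holds_ex hE.eval_twoPowTerm (hE.twoPow_le x)]
  refine exists_congr fun c' => and_congr_right fun hc' => ?_
  rw [holds_conj, holds_neg, hE.holds_lossTerm (x := y) (c := c') (by norm_num) (by simp)
    (by simp [eval]), not_not, hL.eq_zero_iff y hc', hE.holds_all_op (x := y) (by simp)]
  refine and_congr_right fun _ => forall_congr' fun k' => ?_
  rw [holds_iff, holds_conj,
    hE.holds_testBitTerm y (c := c') (i := k') (by norm_num) (by norm_num) (by simp) (by simp) hc'
      (k'.2.trans_le (M.len_le_maxLen y)),
    hE.holds_nextTerm (x := x) (y := y) (k' := k') hd (by simpa) (by simpa) hc (by simp)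
      (by simp),
    hE.holds_sameEventTerm (y := y) (k := k) (k' := k') (by simp) (by simp) (by simp)]

theorem eval_tableTerm_eq_zero_iff (hE : M.EncodedBy B G) (hR : M.RankOneKraus) {n : ℕ}
    (hL : M.IsLossTable B n (G.nat 3)) :
    tableTerm.eval G v = 0 ↔ M.CanAvoidAt B (n + 1) (v 7) := by
  rw [← not_iff_not, tableTerm]
  refine holds_neg.trans (not_congr (hE.holds_ex_choice.trans (exists_congr fun x => ?_)))
  rw [holds_ex hE.eval_twoPowTerm (hE.twoPow_le x)]
  refine exists_congr fun c => and_congr_right fun hc => ?_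
  rw [holds_conj, hE.holds_avoidTerm (x := x) (c := c) (hE.dim_le hR x) hL (by simp) (by simp) hc,
    holds_eq, eval, eval,
    eval_mul (n := M.code x) hE.eval_twoPowTerm (hE.twoPow_le x) (by simp [eval])]
  simp [eval]

theorem holds_answerTerm (hE : M.EncodedBy B G) (hR : M.RankOneKraus) {n : ℕ}
    (hn : Nat.card M.Node ≤ n) (hL : M.IsLossTable B n (G.nat 3)) :
    answerTerm.Holds G v ↔
      ¬ ∃ x i, M.kraus x i ≠ 0 ∧ ∀ m, M.CanAvoid B m ⟨x, {i}⟩ := by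
  rw [answerTerm, holds_neg, hE.holds_ex_choice]
  refine not_congr (exists_congr fun x => ?_)
  rw [hE.holds_ex_op (x := x) (by simp)]
  refine exists_congr fun i => ?_
  have hd := hE.dim_le hR x
  have hi : i < M.maxLen := i.2.trans_le (M.len_le_maxLen x)
  rw [holds_conj, holds_neg, hE.holds_matrixNonzero hd (A := M.kraus x i) fun r c =>
      hE.eval_opEntry hd (x := x) (k := i) (by norm_num) (by norm_num) (by norm_num)
        (by simp) (by simp) (by simp) (by simp),
    hE.holds_lossTerm (x := x) (by norm_num) (by simp)
      (hE.eval_powTerm (Function.update_self _ _ _) hi), not_not,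
    hL.eq_zero_iff x (Nat.pow_lt_pow_right one_lt_two hi), codeNode_two_pow]
  exact and_congr_right fun _ => ⟨forall_canAvoid hn, fun h => h n⟩

end EncodedBy

end QMDP

namespace QMDP

open RealRAM NatTerm

variable {M : QMDP} {B : Submodule ℂ (EuclideanSpace ℂ (Fin M.dim))}

/-! ### Reading the input -/

section Lists

variable {α β : Type*} {l : List α} {f : α → List β} {a : α} {i j n : ℕ}

theorem getD_flatMap_of_length_eq_mul {g : α → ℕ} (hf : ∀ a, (f a).length = n * g a)
    (ha : l[i]? = some a) (hj : j < n * g a) (d : β) :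
    (l.flatMap f).getD (n * ∑ z ∈ Finset.range i, (l.map g).getD z 0 + j) d = (f a).getD j d := by
  induction l generalizing i with
  | nil => simp at ha
  | cons b l ih =>
    cases i with
    | zero =>
      obtain rfl : b = a := by simpa using ha
      simpa using List.getD_append _ _ d _ (hj.trans_eq (hf b).symm)
    | succ i =>
      rw [List.flatMap_cons, Finset.sum_range_succ', ← ih (by simpa using ha)]
      simp only [List.map_cons, List.getD_cons_succ, List.getD_cons_zero, mul_add]
      rw [List.getD_append_right _ _ _ _ (by rw [hf]; omega), hf]
      congr 1
      omega

theorem getD_flatMap_of_length_eq (hf : ∀ a, (f a).length = n) (ha : l[i]? = some a) (hj : j < n)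
    (d : β) : (l.flatMap f).getD (n * i + j) d = (f a).getD j d := by
  have hi := (List.getElem?_eq_some_iff.1 ha).1
  rw [← getD_flatMap_of_length_eq_mul (g := fun _ => 1) (by simpa using hf) ha (by simpa) d,
    Finset.sum_congr rfl fun z hz => ?_, Finset.sum_const, Finset.card_range, smul_eq_mul, mul_one]
  have hz' := (Finset.mem_range.1 hz).trans hi
  simp [hz']

end Lists

section Entries

variable {d : ℕ} (A : Matrix (Fin d) (Fin d) ℂ)

theorem length_matrixEntries : (matrixEntries A).length = d * (d * 2) := by
  simp [matrixEntries, List.length_flatMap]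

theorem entry_lt (r c : Fin d) {q : ℕ} (hq : q < 2) : 2 * (d * r + c) + q < d * (d * 2) :=
  calc 2 * (d * r + c) + q < 2 * (d * (r + 1)) := by rw [mul_add_one]; omega
    _ ≤ 2 * (d * d) := by gcongr; exact r.2
    _ = d * (d * 2) := by ring

theorem getD_matrixEntries (r c : Fin d) {q : ℕ} (hq : q < 2) :
    (matrixEntries A).getD (2 * (d * r + c) + q) 0 = [(A r c).re, (A r c).im].getD q 0 := by
  have hindex : 2 * (d * r + c) + q = d * 2 * r + (2 * c + q) := by ring
  rw [hindex, matrixEntries, getD_flatMap_of_length_eq (a := r)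
    (fun _ => by simp [List.length_flatMap]) (by simp) (by omega),
    getD_flatMap_of_length_eq (a := c) (n := 2) (fun _ => rfl) (by simp) hq]

end Entries

theorem choices_getElem? (x : M.Choice) : M.choices[M.code x]? = some x := by
  match x with
  | Sum.inl α => simp [choices, code, List.getElem?_append]
  | Sum.inr β => simp [choices, code]

theorem length_choices : M.choices.length = M.numAct + M.numMeas := by
  simp [choices]

theorem getD_map_choices (f : M.Choice → ℕ) (x : M.Choice) :
    (M.choices.map f).getD (M.code x) 0 = f x := by
  simp [List.getD_eq_getElem?_getD, choices_getElem?]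

theorem sup_inputStore_lens :
    (Finset.range (M.numAct + M.numMeas)).sup ((M.inputStore B).nat 2) = M.maxLen := by
  apply le_antisymm
  · refine Finset.sup_le fun i hi => ?_
    obtain ⟨x, rfl⟩ :=
      (M.exists_lt_iff_exists_code (p := (i = ·))).1 ⟨i, Finset.mem_range.1 hi, rfl⟩
    exact (getD_map_choices _ x).trans_le (M.len_le_maxLen x)
  · refine Finset.sup_le fun x _ => (getD_map_choices (fun x => (M.fam x).len) x).symm.trans_le ?_
    exact Finset.le_sup (f := (M.inputStore B).nat 2) (Finset.mem_range.2 (M.code_lt x))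

theorem inputStore_avail (x y : M.Choice) :
    (M.inputStore B).nat 3 ((M.numAct + M.numMeas) * M.code x + M.code y) ≠ 0 ↔ y ∈ M.avail x := by
  have hget := getD_flatMap_of_length_eq
    (f := fun x => M.choices.map fun y => if y ∈ M.avail x then 1 else 0)
    (fun _ => by rw [List.length_map, length_choices]) (choices_getElem? x) (M.code_lt y) 0
  refine (not_congr (Eq.congr_left (hget.trans (getD_map_choices _ y)))).trans ?_
  simp

theorem inputStore_op (x : M.Choice) (k : Fin (M.fam x).len) (r c : Fin M.dim) {q : ℕ}
    (hq : q < 2) :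
    (M.inputStore B).real 1 (2 * (M.dim * (M.dim * (∑ z ∈ Finset.range (M.code x),
      (M.inputStore B).nat 2 z + k) + r) + c) + q) =
      [(M.kraus x k r c).re, (M.kraus x k r c).im].getD q 0 := by
  have hentry := entry_lt r c hq
  have hlt : M.dim * (M.dim * 2) * k + (2 * (M.dim * r + c) + q) <
      M.dim * (M.dim * 2) * (M.fam x).len :=
    calc _ < M.dim * (M.dim * 2) * (k + 1) := by rw [mul_add_one]; omega
      _ ≤ _ := Nat.mul_le_mul_left _ k.2
  have hindex (S : ℕ) : 2 * (M.dim * (M.dim * (S + k) + r) + c) + q =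
      M.dim * (M.dim * 2) * S + (M.dim * (M.dim * 2) * k + (2 * (M.dim * r + c) + q)) := by
    ring
  rw [hindex]
  refine (getD_flatMap_of_length_eq_mul (g := fun x => (M.fam x).len)
    (fun x => ?_) (choices_getElem? x) hlt 0).trans ?_
  · simp [List.length_flatMap, length_matrixEntries, mul_comm]
  · rw [getD_flatMap_of_length_eq (a := k) (fun _ => length_matrixEntries _) (by simp) hentry]
    exact getD_matrixEntries _ r c hq

theorem rankOneKraus_of_rankOne (hact : ∀ α, (M.act α).RankOne) (hmeas : ∀ β, (M.meas β).RankOne) :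
    M.RankOneKraus := by
  intro x k
  obtain ⟨a, φ, ψ, h⟩ :
      ∃ (a : ℂ) (φ ψ : Fin M.dim → ℂ), M.kraus x k = a • vecMulVec φ (star ψ) := by
    match x, k with
    | Sum.inl α, k => exact hact α k
    | Sum.inr β, k => exact hmeas β k
  exact ⟨a • φ, star ψ, by rw [h, smul_vecMulVec]⟩

end QMDP

namespace RealRAM

/-- The tables that a store represents. -/
def Store.tables (s : Store) : Tables := ⟨fun a => s.nat (a + 1), fun a => s.real a⟩

theorem represents_tables (s : Store) : Represents s s.tables (s.nat 5) :=
  ⟨rfl, fun _ => rfl, fun _ => rfl⟩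

theorem SameBelow.tables_eq {k : ℕ} {s s' : Store} (h : SameBelow k s s') :
    s'.tables = s.tables := by
  rw [Store.tables, Store.tables, Tables.mk.injEq]
  exact ⟨funext fun a => h.nat _ (Nat.succ_ne_zero _), funext fun a => h.real _ a.2.ne⟩

theorem Store.setNat_tables (s : Store) {a : ℕ} (ha : 4 < a) (i v : ℕ) :
    (s.setNat a i v).tables = s.tables := by
  rw [Store.tables, Store.tables, Tables.mk.injEq]
  exact ⟨funext fun b => by rw [setNat_nat, if_neg (by omega)], rfl⟩

/-- `s'` differs from `s` at most in the natural number arrays in `A`. -/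
def SameExcept (A : Finset ℕ) (s s' : Store) : Prop :=
  (∀ a ∉ A, s'.nat a = s.nat a) ∧ s'.real = s.real

theorem SameExcept.refl (A : Finset ℕ) (s : Store) : SameExcept A s s :=
  ⟨fun _ _ => rfl, rfl⟩

theorem SameExcept.setNat {A : Finset ℕ} {a : ℕ} {s s' : Store} (h : SameExcept A s s') (ha : a ∈ A)
    (i v : ℕ) : SameExcept A s (s'.setNat a i v) :=
  ⟨fun b hb => by simp [ne_of_mem_of_not_mem ha hb |>.symm, h.1 b hb], h.2⟩

/-- The number of choices. -/
abbrev numChoicesExpr : NatExpr := .add (.read 1 (.lit 1)) (.read 1 (.lit 2))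

/-- Code that leaves the maximal number of operators in cell `0` of array `6`; the maximum of two
numbers is computed by means of truncated subtraction. -/
def maxLenProg : Prog :=
  forLoop 5 8 numChoicesExpr <| .setNat 6 (.lit 0)
    (.add (.read 6 (.lit 0)) (.sub (.read 2 (.read 5 (.lit 8))) (.read 6 (.lit 0))))

theorem runs_maxLenProg {s : Store} {n : ℕ} (hn : s.nat 1 1 + s.nat 1 2 = n) (h0 : s.nat 6 0 = 0) :
    Runs maxLenProg s (n * 25 + 11) fun s' =>
      s'.nat 6 0 = (Finset.range n).sup (s.nat 2) ∧ SameExcept {5, 6} s s' := by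
  refine (Runs.forLoop (n := n) (T := 11)
    (fun i s' => s'.nat 6 0 = (Finset.range i).sup (s.nat 2) ∧ SameExcept {5, 6} s s')
    (fun i s' ⟨_, hsame⟩ => ?_) ⟨by simpa using h0, (SameExcept.refl _ s).setNat (by decide) _ _⟩
    fun i _ s' hi ⟨hmax, hsame⟩ => Runs.setNat ⟨by simp [hi], ?_,
      (hsame.setNat (by decide) _ _).setNat (by decide) _ _⟩).mono_time le_rfl
  · simpa [NatExpr.val, hsame.1 1 (by decide)] using hn
  · simp [NatExpr.val, hi, hmax, hsame.1 2 (by decide), Finset.range_add_one]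
    omega

/-- Code that, with `N` in cell `0` of array `6`, puts `2 ^ N` into cell `4`, the number of choices
times `2 ^ N` into cell `3`, and the powers `2 ^ 0, …, 2 ^ (N - 1)` into the cells from `5` on of
array `1`. -/
def powersProg : Prog :=
  .seq (.setNat 1 (.lit 4) (.lit 1)) <| .seq (.setNat 1 (.lit 3) numChoicesExpr) <|
  forLoop 5 8 (.read 6 (.lit 0)) <|
  .seq (.setNat 1 (.add (.lit 5) (.read 5 (.lit 8))) (.read 1 (.lit 4))) <|
  .seq (.setNat 1 (.lit 4) (.add (.read 1 (.lit 4)) (.read 1 (.lit 4)))) <|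
  .setNat 1 (.lit 3) (.add (.read 1 (.lit 3)) (.read 1 (.lit 3)))

/-- The postcondition of `powersProg`, started in `s`. -/
structure HasPowers (s : Store) (n N : ℕ) (s' : Store) : Prop where
  bound : s'.nat 1 3 = n * 2 ^ N
  twoPow : s'.nat 1 4 = 2 ^ N
  pow : ∀ i < N, s'.nat 1 (5 + i) = 2 ^ i
  input : ∀ i < 3, s'.nat 1 i = s.nat 1 i
  same : SameExcept {1, 5} s s'

theorem HasPowers.succ {s s' : Store} {n N : ℕ} (h : HasPowers s n N s') :
    HasPowers s n (N + 1) ((((s'.setNat 1 (5 + N) (2 ^ N)).setNat 1 4 (2 ^ N + 2 ^ N)).setNat 1 3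
      (n * 2 ^ N + n * 2 ^ N)).setNat 5 8 (N + 1)) where
  bound := by simp; ring
  twoPow := by simp; ring
  pow i hi := by
    obtain hi | rfl := Nat.lt_succ_iff_lt_or_eq.1 hi
    · simp (disch := omega) [h.pow i hi]
    · simp (disch := omega)
  input i hi := by simp (disch := omega) [h.input i hi]
  same := (((h.same.setNat (by decide) _ _).setNat (by decide) _ _).setNat (by decide) _ _).setNat
    (by decide) _ _

theorem runs_powersProg {s : Store} {n N : ℕ} (hn : s.nat 1 1 + s.nat 1 2 = n)
    (hN : s.nat 6 0 = N) : Runs powersProg s (N * 32 + 18) (HasPowers s n N) := by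
  have hstart : HasPowers s n 0 (((s.setNat 1 4 1).setNat 1 3 n).setNat 5 8 0) :=
    ⟨by simp, by simp, by simp, fun i hi => by simp (disch := omega),
      (((SameExcept.refl _ s).setNat (by decide) _ _).setNat (by decide) _ _).setNat
        (by decide) _ _⟩
  refine (Runs.setNat_seq <| Runs.setNat_seq <| Runs.forLoop (n := N) (T := 21) (HasPowers s n)
    (fun i s' h => ?_) ?_ fun i _ s' hi h => ?_).mono_time ?_
  · simpa [NatExpr.val, h.same.1 6 (by decide)] using hN
  · simpa [NatExpr.val, hn] using hstart
  · refine Runs.setNat_seq <| Runs.setNat_seq <| Runs.setNat ⟨?_, ?_⟩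
    · simp [NatExpr.val, hi]
    · simpa (disch := omega) [NatExpr.val, hi, h.twoPow, h.bound] using h.succ
  · simp only [NatExpr.cost]
    omega

end RealRAM

namespace QMDP

open RealRAM NatTerm

variable {M : QMDP} {B : Submodule ℂ (EuclideanSpace ℂ (Fin M.dim))} {n r : ℕ} {s s' : Store}

theorem isLossTable_zero : M.IsLossTable B 0 0 := by
  intro j hj
  obtain ⟨x, hx⟩ := (M.exists_lt_iff_exists_code (p := (j / 2 ^ M.maxLen = ·))).1
    ⟨_, Nat.div_lt_of_lt_mul (by rwa [mul_comm]), rfl⟩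
  refine iff_of_true rfl ⟨x, j % 2 ^ M.maxLen, Nat.mod_lt _ (by positivity), ?_, trivial⟩
  rw [← hx, Nat.div_add_mod]

theorem numChoices_le_bound (M : QMDP) :
    M.numAct + M.numMeas ≤ (M.numAct + M.numMeas) * 2 ^ M.maxLen :=
  Nat.le_mul_of_pos_right _ (by positivity)

theorem maxLen_le_bound (M : QMDP) : M.maxLen ≤ (M.numAct + M.numMeas) * 2 ^ M.maxLen :=
  Finset.sup_le fun x _ => (M.len_le_maxLen x).trans <| Nat.lt_two_pow_self.le.trans <|
    Nat.le_mul_of_pos_left _ ((Nat.zero_le _).trans_lt (M.code_lt x))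

theorem encodedBy_tables {s₁ : Store} (h₁ : SameExcept {5, 6} (M.inputStore B) s₁)
    (h : HasPowers s₁ (M.numAct + M.numMeas) M.maxLen s) : M.EncodedBy B s.tables := by
  have hinput (i : ℕ) (hi : i < 3) : s.nat 1 i = (M.inputStore B).nat 1 i := by
    rw [h.input i hi, h₁.1 1 (by decide)]
  have hlens : s.nat 2 = (M.inputStore B).nat 2 :=
    (h.same.1 2 (by decide)).trans (h₁.1 2 (by decide))
  have havail : s.nat 3 = (M.inputStore B).nat 3 :=
    (h.same.1 3 (by decide)).trans (h₁.1 3 (by decide))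
  have hreal : s.real = (M.inputStore B).real := h.same.2.trans h₁.2
  exact {
    dim := hinput 0 (by decide)
    numAct := hinput 1 (by decide)
    numMeas := hinput 2 (by decide)
    bound := h.bound
    twoPow := h.twoPow
    pow := h.pow
    len x := (congrFun hlens _).trans (getD_map_choices _ x)
    avail x y := by
      rw [← inputStore_avail (B := B), ← havail]
      rfl
    proj r c := by
      refine Complex.ext ((congrFun₂ hreal 0 _).trans ?_) ((congrFun₂ hreal 0 _).trans ?_)
      · exact getD_matrixEntries _ r c (q := 0) (by decide)
      · exact getD_matrixEntries _ r c (q := 1) (by decide)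
    op x k r c := by
      change s.tables.complex 1 (M.dim * (M.dim * (∑ z ∈ Finset.range (M.code x),
        s.nat 2 z + k) + r) + c) = _
      rw [hlens]
      refine Complex.ext ((congrFun₂ hreal 1 _).trans ?_) ((congrFun₂ hreal 1 _).trans ?_)
      · exact inputStore_op x k r c (q := 0) (by decide)
      · exact inputStore_op x k r c (q := 1) (by decide) }

/-- Code that computes the encoding of a process from its input. -/
def encodeProg : Prog := .seq maxLenProg powersProg

theorem runs_encodeProg (M : QMDP) (B : Submodule ℂ (EuclideanSpace ℂ (Fin M.dim))) :
    Runs encodeProg (M.inputStore B) ((M.numAct + M.numMeas) * 2 ^ M.maxLen * 57 + 29) fun s =>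
      M.EncodedBy B s.tables ∧ M.IsLossTable B 0 (s.nat 4) := by
  have hmaxLen := runs_maxLenProg (s := M.inputStore B) (n := M.numAct + M.numMeas) rfl rfl
  refine (hmaxLen.seq (T₂ := M.maxLen * 32 + 18) fun s₁ ⟨hmax, h₁⟩ => ?_).mono_time ?_
  · have hn : s₁.nat 1 1 + s₁.nat 1 2 = M.numAct + M.numMeas := by
      rw [h₁.1 1 (by decide)]
      rfl
    refine (runs_powersProg hn (hmax.trans sup_inputStore_lens)).mono le_rfl fun s h =>
      ⟨encodedBy_tables h₁ h, ?_⟩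
    rw [h.same.1 4 (by decide), h₁.1 4 (by decide)]
    exact isLossTable_zero
  · have := M.numChoices_le_bound
    have := M.maxLen_le_bound
    omega

/-! ### The decision procedure -/

theorem EncodedBy.of_sameExcept (hE : M.EncodedBy B s.tables) (h : SameExcept {4, 5} s s') :
    M.EncodedBy B s'.tables := by
  have hnat (a : Fin 4) (ha : a ≠ 3) : s'.tables.nat a = s.tables.nat a :=
    h.1 (a + 1) (by fin_cases a <;> simp_all)
  have hcomplex (a : Fin 2) : s'.tables.complex a = s.tables.complex a := by
    ext i
    simp only [Tables.complex, Store.tables, h.2]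
  constructor <;> simp only [Tables.bound, hnat 0 (by decide), hnat 1 (by decide),
    hnat 2 (by decide), hcomplex]
  exacts [hE.dim, hE.numAct, hE.numMeas, hE.bound, hE.twoPow, hE.pow, hE.len, hE.avail, hE.proj,
    hE.op]

/-- Code that puts the next table of lost nodes into array `6`. -/
def nextTableProg : Prog :=
  forLoop 5 7 boundCell <| .seq (tableTerm.comp 0) (.setNat 6 (.read 5 (.lit 7)) (stackCell 0))

theorem runs_nextTableProg (hR : M.RankOneKraus) (hE : M.EncodedBy B s.tables)
    (hL : M.IsLossTable B n (s.nat 4)) :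
    Runs nextTableProg s (s.tables.bound * (tableTerm.time.eval s.tables.bound + 16) + 8)
      fun s' => s'.tables = s.tables ∧ s'.nat 5 8 = s.nat 5 8 ∧
        M.IsLossTable B (n + 1) (s'.nat 6) := by
  simp only [IsLossTable, ← hE.bound]
  refine Runs.forLoop (T := tableTerm.time.eval s.tables.bound + 5)
    (fun i s' => s'.tables = s.tables ∧ s'.nat 5 8 = s.nat 5 8 ∧
      ∀ j < i, s'.nat 6 j = 0 ↔ M.CanAvoidAt B (n + 1) j)
    (fun i s' ⟨htables, _⟩ => congrArg Tables.bound htables)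
    ⟨s.setNat_tables (by decide) _ _, by simp, by simp⟩
    fun i _ s₁ hcounter ⟨htables, hrounds, hcells⟩ =>
      (computes_comp s.tables _ 0 tableTerm s₁ (htables ▸ represents_tables s₁)).seq
        fun s₂ ⟨hval, hsame⟩ => Runs.setNat ?_
  have hvars : s₂.nat 5 = s₁.nat 5 := hsame.nat 5 (by decide)
  have hnext : s₂.nat 0 0 = 0 ↔ M.CanAvoidAt B (n + 1) i := by
    rw [hval, hE.eval_tableTerm_eq_zero_iff hR hL, hcounter]
  have hindex : s₂.nat 5 7 = i := by rw [hvars, hcounter]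
  refine ⟨by simpa using hindex, ?_, by simpa [hvars] using hrounds, fun j hj => ?_⟩
  · rw [Store.setNat_tables _ (by decide), Store.setNat_tables _ (by decide), hsame.tables_eq,
      htables]
  · obtain hj | rfl := Nat.lt_succ_iff_lt_or_eq.1 hj
    · simpa [NatExpr.val, hindex, hj.ne, hsame.nat 6 (by decide)] using hcells j hj
    · simpa [NatExpr.val, hindex] using hnext

/-- Code that copies the table of lost nodes from array `6` to array `4`. -/
def copyTableProg : Prog :=
  forLoop 5 7 boundCell <| .setNat 4 (.read 5 (.lit 7)) (.read 6 (.read 5 (.lit 7)))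

theorem runs_copyTableProg (s : Store) :
    Runs copyTableProg s (s.tables.bound * 17 + 8) fun s' =>
      SameExcept {4, 5} s s' ∧ s'.nat 5 8 = s.nat 5 8 ∧
        ∀ j < s.tables.bound, s'.nat 4 j = s.nat 6 j := by
  refine Runs.forLoop (T := 6)
    (fun i s' => SameExcept {4, 5} s s' ∧ s'.nat 5 8 = s.nat 5 8 ∧
      ∀ j < i, s'.nat 4 j = s.nat 6 j)
    (fun i s' ⟨hsame, _⟩ => congrFun (hsame.1 1 (by decide)) 3)
    ⟨(SameExcept.refl _ s).setNat (by decide) _ _, by simp, by simp⟩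
    fun i _ s₁ hcounter ⟨hsame, hrounds, hcells⟩ => Runs.setNat ⟨by simpa using hcounter,
      (hsame.setNat (by decide) _ _).setNat (by decide) _ _, by simpa using hrounds,
      fun j hj => ?_⟩
  obtain hj | rfl := Nat.lt_succ_iff_lt_or_eq.1 hj
  · simpa [NatExpr.val, hcounter, hj.ne] using hcells j hj
  · simp [NatExpr.val, hcounter, hsame.1 6 (by decide)]

/-- Code that turns the table of lost nodes for `n` rounds into the one for `n + 1` rounds. -/
def roundProg : Prog := .seq nextTableProg copyTableProg

theorem runs_roundProg (hR : M.RankOneKraus) (hE : M.EncodedBy B s.tables)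
    (hL : M.IsLossTable B n (s.nat 4)) :
    Runs roundProg s (s.tables.bound * (tableTerm.time.eval s.tables.bound + 33) + 16) fun s' =>
      s'.nat 5 8 = s.nat 5 8 ∧ M.EncodedBy B s'.tables ∧ M.IsLossTable B (n + 1) (s'.nat 4) := by
  refine ((runs_nextTableProg hR hE hL).seq fun s₁ ⟨htables, hrounds, hnext⟩ =>
    (htables ▸ runs_copyTableProg s₁).mono le_rfl fun s₂ ⟨hsame, hrounds', hcopy⟩ =>
      ⟨hrounds'.trans hrounds, (htables ▸ hE : M.EncodedBy B s₁.tables).of_sameExcept hsame,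
        fun j hj => ?_⟩).mono_time (le_of_eq (by ring))
  rw [hcopy j (hE.bound ▸ hj), hnext j hj]

/-- Code that decides whether a process always reaches a subspace. -/
def deciderProg : Prog :=
  .seq encodeProg <| .seq (forLoop 5 8 boundCell roundProg) (answerTerm.comp 0)

/-- A bound for the running time of `deciderProg`, as a polynomial in the number of choices times
`2 ^ M.maxLen`. -/
noncomputable def deciderTime : Polynomial ℕ :=
  .X * (.X * (tableTerm.time + 33) + 27) + .X * 57 + 37 + answerTerm.time

theorem runs_rounds (hR : M.RankOneKraus) (hE : M.EncodedBy B s.tables)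
    (hL : M.IsLossTable B 0 (s.nat 4)) :
    Runs (forLoop 5 8 boundCell roundProg) s
      (s.tables.bound * (s.tables.bound * (tableTerm.time.eval s.tables.bound + 33) + 27) + 8)
      fun s' => M.EncodedBy B s'.tables ∧ M.IsLossTable B s.tables.bound (s'.nat 4) := by
  refine Runs.forLoop (fun i s' => M.EncodedBy B s'.tables ∧ M.IsLossTable B i (s'.nat 4))
    (fun i s' ⟨hE', _⟩ => hE'.bound.trans hE.bound.symm)
    ⟨by rwa [Store.setNat_tables _ (by decide)], by simpa⟩ fun i _ s₁ hcounter ⟨hE₁, hL₁⟩ => ?_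
  rw [hE.bound, ← hE₁.bound]
  refine (runs_roundProg hR hE₁ hL₁).mono le_rfl fun s₂ ⟨hrounds, hE₂, hL₂⟩ =>
    ⟨hrounds.trans hcounter, ?_, by simpa⟩
  rwa [Store.setNat_tables _ (by decide)]

theorem decidesWithin_comp_answerTerm (hB : M.Invariant B) (hR : M.RankOneKraus)
    (hE : M.EncodedBy B s.tables) (hL : M.IsLossTable B s.tables.bound (s.nat 4)) :
    DecidesWithin (answerTerm.comp 0) s (M.AlwaysReaches B)
      (answerTerm.time.eval s.tables.bound) := by
  obtain ⟨s', t, hexec, ht, hval, -⟩ := computes_comp _ _ 0 answerTerm s (represents_tables s)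
  have hanswer : answerTerm.Holds s.tables (s.nat 5) ↔ M.AlwaysReaches B :=
    (hE.holds_answerTerm hR (M.card_node_le.trans_eq hE.bound.symm) hL).trans
      (alwaysReaches_iff hB hR).symm
  refine ⟨s', t, hexec, ht, fun h => ?_, fun h => ?_⟩
  · have hne := hanswer.2 h
    have hle : answerTerm.eval s.tables (s.nat 5) ≤ 1 := by
      rw [answerTerm, NatTerm.neg, eval]
      exact Nat.sub_le 1 _
    rw [hval]
    exact hle.antisymm (Nat.one_le_iff_ne_zero.2 hne)
  · rw [hval]
    exact not_not.1 (mt hanswer.1 h)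

theorem decidesWithin_deciderProg (hB : M.Invariant B) (hR : M.RankOneKraus) :
    DecidesWithin deciderProg (M.inputStore B) (M.AlwaysReaches B)
      (deciderTime.eval ((M.numAct + M.numMeas) * 2 ^ M.maxLen)) := by
  obtain ⟨s₁, t₁, hencode, ht₁, hE₁, hL₁⟩ := runs_encodeProg M B
  obtain ⟨s₂, t₂, hrounds, ht₂, hE₂, hL₂⟩ := runs_rounds hR hE₁ hL₁
  rw [hE₁.bound] at ht₂
  rw [hE₁.bound, ← hE₂.bound] at hL₂
  obtain ⟨s₃, t₃, hanswer, ht₃, hpos, hneg⟩ := decidesWithin_comp_answerTerm hB hR hE₂ hL₂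
  rw [hE₂.bound] at ht₃
  refine ⟨s₃, _, .seq hencode (.seq hrounds hanswer), ?_, hpos, hneg⟩
  unfold deciderTime
  simp only [Polynomial.eval_add, Polynomial.eval_mul, Polynomial.eval_X, Polynomial.eval_ofNat]
  omega

end QMDP

theorem mainTheorem10 :
    ∃ (prog : RealRAM.Prog) (poly : Polynomial ℕ),
      ∀ (M : QMDP) (B : Submodule ℂ (EuclideanSpace ℂ (Fin M.dim))),
        M.Invariant B →
        (∀ α, (M.act α).RankOne) →
        (∀ β, (M.meas β).RankOne) →
        RealRAM.DecidesWithin prog (M.inputStore B) (M.AlwaysReaches B)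
          (poly.eval ((M.numAct + M.numMeas) * 2 ^ M.maxLen)) := by
  exact ⟨QMDP.deciderProg, QMDP.deciderTime, fun M B hB hact hmeas =>
    QMDP.decidesWithin_deciderProg hB (QMDP.rankOneKraus_of_rankOne hact hmeas)⟩
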